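/- \textbf{Definitions.} Identify the unit squares of the infinite chessboard with their centers, the points of $\mathbb{Z}^2$; a \emph{board} is a set of squares. For nonnegative integers $p$, $q$, not both zero, a \emph{$(p,q)$-leaper} is the piece that moves from a square $a$ to the squares $a+(\pm p,\pm q)$ and $a+(\pm q,\pm p)$; a $(p,q)$-leaper and a $(q,p)$-leaper are the same piece. It is \emph{skew} if $p\ne0$, $q\ne0$ and $p\neq q$, and \emph{basic} if $p+q$ is odd and $\gcd(p,q)=1$. The \emph{leaper graph} of a leaper over a board $B$ has the squares of $B$ as its vertices, two of them being adjacent when a move of the leaper joins them. A board $B$ is \emph{dual} with respect to two leapers if these are distinct, $B$ contains more than one square, and the leaper graphs of the two leapers over $B$ are connected and isomorphic. Let \[A_f=\begin{pmatrix}1&0\\2&1\end{pmatrix},\quad A_g=\begin{pmatrix}0&1\\-1&2\end{pmatrix},\quad A_h=A_\hbar=\begin{pmatrix}0&1\\1&2\end{pmatrix},\qquad A_{e_1e_2\ldots e_l}=A_{e_1}A_{e_2}\cdots A_{e_l}.\] Number the directions E, NE, N, NW, W, SW, S, SE by $0,1,\ldots,7$ (modulo $8$), and let $u_0=(1,0)$,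 $u_1=(1,1)$, $u_2=(0,1)$, \ldots, $u_7=(1,-1)$. Consider cycles written as a concatenation $a^0a^1\ldots a^7$ of eight paths of squares, and write $-w$ for the reversal of a path $w$. The lifts of $a^0a^1\ldots a^7$ with parameters $(p,q)$ are the cycles $b^0b^1\ldots b^7$, together with this partitioning, given as follows. \begin{itemize} \item $f$-lift: $b^i=(-a^{i+5})(-a^{i+4})(-a^{i+3})+(p+q)u_i$ for even $i$, and $b^i=a^i+pu_i$ for odd $i$. \item $g$-lift: $b^i=a^i+(q-p)u_i$ for even $i$, and $b^i=(-a^{i+5})(-a^{i+4})(-a^{i+3})+qu_i$ for odd $i$. \item $h$-lift: $b^i=(-a^{i+6})(-a^{i+5})(-a^{i+4})(-a^{i+3})(-a^{i+2})+(p+q)u_i$ for even $i$, and $b^i=a^{i-1}a^ia^{i+1}+qu_i$ for odd $i$. \item $\hbar$-lift: $b^i=a^{i-1}a^ia^{i+1}+(p+q)u_i$ for even $i$, and $b^i=(-a^{i+6})(-a^{i+5})(-a^{i+4})(-a^{i+3})(-a^{i+2})+qu_i$ for odd $i$. \end{itemize} Let $M$ be an $(r,s)$-leaper, $r\le s$.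 Its \emph{initial cycles} $D^M_o$ consist of eight one-square paths $a^0,a^1,\ldots,a^7$: \begin{itemize} \item type $o=f$, provided that $r\ne0$: $a^i$ is the square $(r+s)u_i$ for even $i$ and $ru_i$ for odd $i$; \item type $o=g$, provided that $r\neq s$: $a^i$ is the square $(s-r)u_i$ for even $i$ and $su_i$ for odd $i$; \item type $o=h$: $a^i$ is the square $(r+s)u_i$ for even $i$ and $su_i$ for odd $i$. \end{itemize} For a string $e=e_1e_2\ldots e_l$ over $\{f,g,h,\hbar\}$, let $D^M_o(e)$ be the result of successively applying to $D^M_o$ lifts of types $e_l,e_{l-1},\ldots,e_1$, where the lift of type $e_j$ is taken with parameters $(p_j,q_j)^T=A_{e_{j+1}\ldots e_l}A_o(r,s)^T$. Let $B^M_o(e)$ be the board formed by the squares of $D^M_o(e)$. Finally, say that $f$ lifts an $(m,n)$-frame to an $(m,2m+n)$-frame, $g$ lifts it to an $(n,2n-m)$-frame, and $h$ lifts it to an $(n,m+2n)$-frame. The \emph{descent} of a skew basic $(p,q)$-leaper, $p<q$, is the unique string $e_1e_2\ldots e_l$ over $\{f,g,h\}$ such that successively applying $e_l,e_{l-1},\ldots,e_1$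 lifts a $(1,2)$-frame to a $(p,q)$-frame. \textbf{Theorem.} Let $M$ be an $(r,s)$-leaper, $r\le s$, let $o\in\{f,g,h\}$ be such that an initial cycle of $M$ of type $o$ exists, and let $e$ be a (possibly empty) string over $\{f,g,h,\hbar\}$. Then the entries $p$, $q$ of $(p,q)^T=A_eA_o(r,s)^T$ are nonnegative integers, not both zero, and the board $B^M_o(e)$ is dual with respect to $M$ and the $(p,q)$-leaper. \textbf{Corollary.} Let $L$ and $M$ be two distinct skew basic leapers such that the descent of one of them is a suffix of the descent of the other. Then there exists a board dual with respect to $L$ and $M$. -/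

import Mathlib

open scoped Matrix

/-- A leaper with proportions `p` and `q`: nonnegative integers, at least one of them positive. -/
structure Leaper where
  p : ℕ
  q : ℕ
  pos : 0 < p ∨ 0 < q

namespace Leaper

/-- The translations `(±p, ±q)` and `(±q, ±p)`. A `(p, q)`-leaper and a `(q, p)`-leaper are the
same piece, so two leapers are distinct pieces when these sets differ. Squares are identified with
their centers, the points of `ℤ × ℤ`. -/
def moves (L : Leaper) : Set (ℤ × ℤ) :=
  {v | (|v.1| = L.p ∧ |v.2| = L.q) ∨ (|v.1| = L.q ∧ |v.2| = L.p)}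

/-- `p ≠ 0`, `q ≠ 0` and `p ≠ q`. -/
def Skew (L : Leaper) : Prop := L.p ≠ 0 ∧ L.q ≠ 0 ∧ L.p ≠ L.q

/-- `p + q` is odd, and `p` and `q` are relatively prime. -/
def Basic (L : Leaper) : Prop := Odd (L.p + L.q) ∧ Nat.Coprime L.p L.q

theorem neg_mem_moves (L : Leaper) {v : ℤ × ℤ} (h : v ∈ L.moves) : -v ∈ L.moves := by
  simpa [moves] using h

theorem zero_notMem_moves (L : Leaper) : (0 : ℤ × ℤ) ∉ L.moves := by
  have := L.pos
  simp only [moves, Set.mem_ofPred_eq, Prod.fst_zero, Prod.snd_zero, abs_zero]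
  omega

/-- The leaper graph of `L` over the board `B`. -/
def graph (L : Leaper) (B : Set (ℤ × ℤ)) : SimpleGraph B where
  Adj a b := (b : ℤ × ℤ) - a ∈ L.moves
  symm := ⟨fun a b h => by simpa using L.neg_mem_moves h⟩
  loopless := ⟨fun a h => L.zero_notMem_moves (by simpa using h)⟩

end Leaper

/-- The board `B` is dual with respect to the leapers `L` and `M`: these are distinct, `B` has more
than one square, and the leaper graphs of `L` and `M` over `B` are connected and isomorphic. -/
def IsDualBoard (B : Set (ℤ × ℤ)) (L M : Leaper) : Prop :=
  L.moves ≠ M.moves ∧ B.Nontrivial ∧ (L.graph B).Connected ∧ (M.graph B).Connected ∧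
    Nonempty (L.graph B ≃g M.graph B)

/-- The four types of lifting transformations. -/
inductive LiftType
  | f
  | g
  | h
  | hbar

/-- The matrices `A_f`, `A_g`, `A_h` and `A_ħ = A_h`. -/
def LiftType.matrix : LiftType → Matrix (Fin 2) (Fin 2) ℤ
  | .f => !![1, 0; 2, 1]
  | .g => !![0, 1; -1, 2]
  | .h => !![0, 1; 1, 2]
  | .hbar => !![0, 1; 1, 2]

/-- `A_e = A_{e₁} A_{e₂} ⋯ A_{eₗ}`. -/
def stringMatrix (e : List LiftType) : Matrix (Fin 2) (Fin 2) ℤ := (e.map LiftType.matrix).prod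

/-- The eight directions E, NE, N, NW, W, SW, S, SE, numbered `0, …, 7` counterclockwise; addition
of directions is modulo `8`. -/
def dirVec : Fin 8 → ℤ × ℤ :=
  ![(1, 0), (1, 1), (0, 1), (-1, 1), (-1, 0), (-1, -1), (0, -1), (1, -1)]

/-- A cycle written as the concatenation `a^E a^NE … a^SE` of eight paths, one for each direction.
A path is the list of its squares in the order in which they are visited. -/
abbrev OctCycle := Fin 8 → List (ℤ × ℤ)

/-- The path `w + v`. -/
def translatePath (w : List (ℤ × ℤ)) (v : ℤ × ℤ) : List (ℤ × ℤ) := w.map (· + v)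

/-- The `f`-, `g`-, `h`- and `ħ`-lift, with parameters `(p, q)`, of `a^E a^NE … a^SE`, together with
its own partitioning into eight paths. The even directions are E, N, W, S and the odd ones are
NE, NW, SW, SE. -/
def LiftType.lift (t : LiftType) (p q : ℤ) (a : OctCycle) : OctCycle := fun i =>
  match t with
  | .f =>
    if (i : ℕ) % 2 = 0 then
      translatePath ((a (i + 5)).reverse ++ (a (i + 4)).reverse ++ (a (i + 3)).reverse)
        ((p + q) • dirVec i)
    else translatePath (a i) (p • dirVec i)
  | .g =>
    if (i : ℕ) % 2 = 0 then translatePath (a i) ((q - p) • dirVec i)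
    else
      translatePath ((a (i + 5)).reverse ++ (a (i + 4)).reverse ++ (a (i + 3)).reverse)
        (q • dirVec i)
  | .h =>
    if (i : ℕ) % 2 = 0 then
      translatePath
        ((a (i + 6)).reverse ++ (a (i + 5)).reverse ++ (a (i + 4)).reverse ++
          (a (i + 3)).reverse ++ (a (i + 2)).reverse)
        ((p + q) • dirVec i)
    else translatePath (a (i - 1) ++ a i ++ a (i + 1)) (q • dirVec i)
  | .hbar =>
    if (i : ℕ) % 2 = 0 then
      translatePath (a (i - 1) ++ a i ++ a (i + 1)) ((p + q) • dirVec i)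
    else
      translatePath
        ((a (i + 6)).reverse ++ (a (i + 5)).reverse ++ (a (i + 4)).reverse ++
          (a (i + 3)).reverse ++ (a (i + 2)).reverse)
        (q • dirVec i)

/-- Whether an `(r, s)`-leaper has an initial cycle of the given type. There is none of type `ħ`. -/
def Leaper.HasInitialCycle (M : Leaper) : LiftType → Prop
  | .f => M.p ≠ 0
  | .g => M.p ≠ M.q
  | .h => True
  | .hbar => False

/-- The initial cycle of an `(r, s)`-leaper of the given type: eight paths of one square each. (The
value at `ħ` is never used.) -/
def Leaper.initialCycle (M : Leaper) : LiftType → OctCycle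
  | .f => fun i =>
    if (i : ℕ) % 2 = 0 then [((M.p : ℤ) + M.q) • dirVec i] else [(M.p : ℤ) • dirVec i]
  | .g => fun i =>
    if (i : ℕ) % 2 = 0 then [((M.q : ℤ) - M.p) • dirVec i] else [(M.q : ℤ) • dirVec i]
  | .h => fun i =>
    if (i : ℕ) % 2 = 0 then [((M.p : ℤ) + M.q) • dirVec i] else [(M.q : ℤ) • dirVec i]
  | .hbar => fun _ => []

/-- The vector `A_e A_o (r, s)ᵀ`. -/
def Leaper.liftedProportions (M : Leaper) (o : LiftType) (e : List LiftType) : Fin 2 → ℤ :=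
  (stringMatrix e * o.matrix) *ᵥ ![(M.p : ℤ), (M.q : ℤ)]

/-- The cycle `D^M_o(e)`, obtained from the initial cycle of type `o` by successively applying lifts
of types `eₗ, …, e₁`, each with the parameters reached so far. -/
def Leaper.liftedCycle (M : Leaper) (o : LiftType) : List LiftType → OctCycle
  | [] => M.initialCycle o
  | t :: e =>
    t.lift (M.liftedProportions o e 0) (M.liftedProportions o e 1) (M.liftedCycle o e)

/-- The board `B^M_o(e)`, formed by the squares of `D^M_o(e)`. -/
def Leaper.liftedBoard (M : Leaper) (o : LiftType) (e : List LiftType) : Set (ℤ × ℤ) :=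
  {x | ∃ i, x ∈ M.liftedCycle o e i}

/-- `FrameLift e p q`: successively applying lifting transformations of types `eₗ, …, e₁` to a
`(1, 2)`-frame lifts it to a `(p, q)`-frame. Here `f` lifts an `(m, n)`-frame to an
`(m, 2m + n)`-frame, `g` to an `(n, 2n - m)`-frame, and `h` to an `(n, m + 2n)`-frame; every frame
has `m < n`. -/
inductive FrameLift : List LiftType → ℕ → ℕ → Prop
  | base : FrameLift [] 1 2
  | f {e : List LiftType} {m n : ℕ} : FrameLift e m n → FrameLift (.f :: e) m (2 * m + n)
  | g {e : List LiftType} {m n : ℕ} : FrameLift e m n → FrameLift (.g :: e) n (2 * n - m)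
  | h {e : List LiftType} {m n : ℕ} : FrameLift e m n → FrameLift (.h :: e) n (m + 2 * n)

theorem FrameLift.lt {e : List LiftType} {p q : ℕ} (H : FrameLift e p q) : 0 < p ∧ p < q := by
  induction H <;> omega

theorem FrameLift.unique {e : List LiftType} {p q : ℕ} (H : FrameLift e p q) :
    ∀ {e' : List LiftType}, FrameLift e' p q → e' = e := by
  induction e generalizing p q with
  | nil =>
    intro e' H'
    cases H
    generalize hp : 1 = p at H'
    generalize hq : 2 = q at H'
    cases H' with
    | base => rfl
    | f K => have := K.lt; omega
    | g K => have := K.lt; omega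
    | h K => have := K.lt; omega
  | cons t e ih =>
    intro e' H'
    generalize hp : p = p' at H'
    generalize hq : q = q' at H'
    cases H with
    | f K =>
      have hK := K.lt
      cases H' with
      | base => omega
      | f K' =>
        obtain rfl := hp
        obtain rfl := Nat.add_left_cancel hq
        rw [ih K K']
      | g K' => have := K'.lt; omega
      | h K' => have := K'.lt; omega
    | @g _ m n K =>
      have hK := K.lt
      cases H' with
      | base => omega
      | f K' => have := K'.lt; omega
      | @g _ m' n' K' =>
        have := K'.lt
        obtain rfl := hp
        obtain rfl : m = m' := by omega
        rw [ih K K']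
      | h K' => have := K'.lt; omega
    | @h _ m n K =>
      have hK := K.lt
      cases H' with
      | base => omega
      | f K' => have := K'.lt; omega
      | g K' => have := K'.lt; omega
      | @h _ m' n' K' =>
        obtain rfl := hp
        obtain rfl : m = m' := by omega
        rw [ih K K']

theorem FrameLift.exists {p q : ℕ} (h0 : 0 < p) (hpq : p < q) (ho : Odd (p + q))
    (hc : Nat.Coprime p q) : ∃ e, FrameLift e p q := by
  induction hN : p + q using Nat.strong_induction_on generalizing p q with
  | _ N ih =>
    subst hN
    rw [Nat.odd_iff] at ho
    rcases lt_trichotomy (2 * p) q with h2 | h2 | h2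
    · rcases lt_trichotomy (3 * p) q with h3 | h3 | h3
      · obtain ⟨k, rfl⟩ : ∃ k, q = 2 * p + k := ⟨q - 2 * p, by omega⟩
        obtain ⟨e, he⟩ := ih (p + k) (by omega) h0 (by omega) (by rw [Nat.odd_iff]; omega)
          (by simpa using hc) rfl
        exact ⟨_, he.f⟩
      · omega
      · obtain ⟨k, rfl⟩ : ∃ k, q = k + 2 * p := ⟨q - 2 * p, by omega⟩
        obtain ⟨e, he⟩ := ih (k + p) (by omega) (p := k) (q := p) (by omega) (by omega)
          (by rw [Nat.odd_iff]; omega) (by simpa [Nat.coprime_comm] using hc) rfl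
        exact ⟨_, he.h⟩
    · subst h2
      have : p = 1 := Nat.eq_one_of_dvd_coprimes hc dvd_rfl (Dvd.intro_left 2 rfl)
      subst this
      exact ⟨_, .base⟩
    · obtain ⟨k, hk⟩ : ∃ k, q + k = 2 * p := ⟨2 * p - q, by omega⟩
      have hcop : Nat.Coprime k p := by
        refine Nat.Coprime.symm ?_
        refine Nat.coprime_of_dvd fun r hr hrp hrk => ?_
        have hrq : r ∣ q := (Nat.dvd_add_left hrk).1 (hk ▸ hrp.mul_left 2)
        exact hr.one_lt.ne' (Nat.eq_one_of_dvd_coprimes hc hrp hrq)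
      obtain ⟨e, he⟩ := ih (k + p) (by omega) (p := k) (q := p) (by omega) (by omega)
          (by rw [Nat.odd_iff]; omega) hcop rfl
      have := he.g
      rw [show 2 * p - k = q by omega] at this
      exact ⟨_, this⟩

/-- A skew basic leaper has exactly one descent. -/
theorem Leaper.existsUnique_descent (L : Leaper) (hs : L.Skew) (hb : L.Basic) :
    ∃! e, FrameLift e (min L.p L.q) (max L.p L.q) := by
  obtain ⟨h1, h2, h3⟩ := hs
  obtain ⟨e, he⟩ : ∃ e, FrameLift e (min L.p L.q) (max L.p L.q) := by
    refine FrameLift.exists (by omega) (by omega) (by rw [min_add_max]; exact hb.1) ?_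
    rcases le_total L.p L.q with h | h
    · simpa [h] using hb.2
    · simpa [h] using hb.2.symm
  exact ⟨e, he, fun _ h => he.unique h⟩

/-- The descent of a skew basic leaper. -/
noncomputable def Leaper.descent (L : Leaper) (hs : L.Skew) (hb : L.Basic) : List LiftType :=
  (L.existsUnique_descent hs hb).choose

/-!
# Boards on which two leapers have isomorphic connected leaper graphs

Fix an `(r, s)`-leaper, and let `ℓ₀, …, ℓ₇` be the moves, in counterclockwise order, of the second
leaper, whose proportions `p` and `q` change along with the cycle `a⁰a¹…a⁷` from lift to lift. The
theorem holds because the cycle determines both leaper graphs over its squares: the first one is the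
cycle itself, and in the second one the move `ℓₖ` carries `aᵏ⁺⁴aᵏ⁺⁵` onto the reversal of `aᵏaᵏ⁺¹`,
while there are no other adjacencies. The structure `LeaperCycle.Octagon` expresses this. It follows
that every square has exactly two neighbours in both graphs (`Octagon.exists_step_neighbors`,
`Octagon.add_move_mem_iff`). The first graph is connected because it contains the cycle. The second
one is connected because connectedness is inherited by lifts (`LeapConnected.lift`): moves of the
new leaper join all copies of a square in the lift, and for each old move they join some copies of
its ends. Two finite connected graphs of degree two on the same set of vertices are isomorphic.

It remains to see that lifts preserve the structure. A pair of paths of a lift decomposes into pairs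
of paths of the old cycle, one of them displaced by a vector, and no step or coincidence may occur
in such a pair. Most pairs are too far apart for that, by linear arithmetic over the regions in
which the paths lie (`Region`, `Clear`). For the others the exchange by a move `ℓₖ` replaces a
square by another square of the old cycle and changes the displacement into one for which the old
cycle is already known to be an octagon (`Octagon.exchange_left`, `Octagon.exchange_right`). For the
exchange to be usable again in the next lift, the images of squares under `ℓₖ` must be kept away
from the cycle by more than a coincidence; this is the field `apart_move` of `Octagon`.

Three reductions keep the number of cases small. First, when `r` may be negative or greater than
`s`, all initial cycles are of one type (`exists_proportions`). Secondly, the rotation by an eighth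
of a turn, with a homothety (`turn`), exchanges `f`-lifts with `g`-lifts and `h`-lifts with
`ħ`-lifts, so that only the types `f` and `h` need an argument (`State.f`, `State.h`). Thirdly, the
cycles have all the symmetries of a square, which leaves a few representative pairs of paths
(`Octagon.of_representatives`). The regions are those of a general regime, except on the boards
reached by lifts of type `f` alone from `s ≤ r`, or of type `g` alone from `r ≤ 0`; on these the
moves of the first leaper are not short in comparison with those of the second one, and a more
precise description is needed (`Params`).

As for the corollary, let the descent of a leaper be `e t d`, where `d` is the descent of another
one, which is an `(m, n)`-leaper with `m < n`. The proportions of the first leaper are then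
`A_e A_t (m, n)ᵀ` (`FrameLift.exists_append`), so the theorem applies to the initial cycle of type
`t`.
-/

namespace LeaperCycle

/-! ### Induced paths -/

section InducedPath

variable {V W : Type*} [AddCommGroup V] [AddCommGroup W]

/-- The vector `v` is zero or satisfies `St`. -/
def Near (St : V → Prop) (v : V) : Prop := v = 0 ∨ St v

/-- No square of `l₂` is `Near` a square of `l₁` displaced by `v`. -/
def Apart (St : V → Prop) (l₁ l₂ : List V) (v : V) : Prop :=
  ∀ x ∈ l₁, ∀ y ∈ l₂, ¬ Near St (y - x - v)

/-- The only step or coincidence between `l₁` and `l₂` is the step from the last element of `l₁` to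
the first element of `l₂`. -/
structure Linked (St : V → Prop) (l₁ l₂ : List V) : Prop where
  ends : ∀ x ∈ l₁, ∀ y ∈ l₂, Near St (y - x) → l₁.getLast? = some x ∧ l₂.head? = some y
  step : ∀ x ∈ l₁.getLast?, ∀ y ∈ l₂.head?, St (y - x)

/-- The list `l` is an induced path of the graph of steps satisfying `St`, without repetitions:
wherever it is cut in two, the parts are `Linked`. -/
def InducedPath (St : V → Prop) (l : List V) : Prop :=
  ∀ l₁ l₂, l = l₁ ++ l₂ → Linked St l₁ l₂

/-- The properties of a set of steps used throughout. -/
structure IsStepSet (St : V → Prop) : Prop where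
  neg : ∀ v, St v → St (-v)
  zero : ¬ St 0

variable {St : V → Prop} {l l₁ l₂ l₃ : List V}

theorem IsStepSet.near_neg (h : IsStepSet St) {v : V} (hv : Near St v) : Near St (-v) := by
  rcases hv with rfl | hv
  · exact Or.inl neg_zero
  · exact Or.inr (h.neg _ hv)

theorem Apart.symm (h : IsStepSet St) {v : V} (H : Apart St l₁ l₂ v) : Apart St l₂ l₁ (-v) :=
  fun x hx y hy hN => H y hy x hx (by
    have := h.near_neg hN
    rwa [show -(y - x - -v) = x - y - v by abel] at this)

theorem Linked.reverse (h : IsStepSet St) (H : Linked St l₁ l₂) :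
    Linked St l₂.reverse l₁.reverse where
  ends x hx y hy hN := by
    have := H.ends y (List.mem_reverse.1 hy) x (List.mem_reverse.1 hx) (by
      simpa using h.near_neg hN)
    simpa using this.symm
  step x hx y hy := by
    have := H.step y (by simpa using hy) x (by simpa using hx)
    simpa using h.neg _ this

theorem InducedPath.reverse (h : IsStepSet St) (H : InducedPath St l) :
    InducedPath St l.reverse := by
  intro l₁ l₂ hl
  have := (H l₂.reverse l₁.reverse (by
    rw [← List.reverse_append, ← hl, List.reverse_reverse])).reverse h
  simpa using this

theorem Linked.ne (h : IsStepSet St) (H : Linked St l₁ l₂) {x : V} (hx : x ∈ l₁) : x ∉ l₂ := by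
  intro hy
  obtain ⟨h1, h2⟩ := H.ends x hx x hy (Or.inl (sub_self x))
  exact h.zero (by simpa using H.step x h1 x h2)

theorem Linked.append_left (H : Linked St l₂ l₃) (hA : Apart St l₁ l₃ 0) (hne : l₂ ≠ []) :
    Linked St (l₁ ++ l₂) l₃ where
  ends x hx y hy hN := by
    rcases List.mem_append.1 hx with hx | hx
    · exact absurd (by simpa using hN) (hA x hx y hy)
    · have := H.ends x hx y hy hN
      rw [List.getLast?_append_of_ne_nil _ hne]
      exact this
  step x hx y hy := by
    rw [List.getLast?_append_of_ne_nil _ hne] at hx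
    exact H.step x hx y hy

theorem InducedPath.append (h : IsStepSet St) (H₁ : InducedPath St l₁) (H₂ : InducedPath St l₂)
    (H : Linked St l₁ l₂) : InducedPath St (l₁ ++ l₂) := by
  -- a cut inside `l₂`; a cut inside `l₁` reduces to it by reversal
  have key : ∀ {l₁ l₂ t s : List V}, Linked St l₁ l₂ → InducedPath St l₂ → l₂ = t ++ s →
      Linked St (l₁ ++ t) s := by
    intro l₁ l₂ t s H H₂ hl
    rcases eq_or_ne t [] with rfl | ht
    · simp only [List.nil_append] at hl
      subst hl
      simpa using H
    · refine (H₂ t s hl).append_left (fun x hx y hy hN => ?_) ht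
      have hN' : Near St (y - x) := by simpa using hN
      have h2 := (H.ends x hx y (by simp [hl, hy]) hN').2
      rw [hl, List.head?_append_of_ne_nil _ ht] at h2
      exact (H₂ t s hl).ne h (List.mem_of_mem_head? h2) hy
  intro u w hl
  rcases List.append_eq_append_iff.1 hl with ⟨t, rfl, ht⟩ | ⟨t, ht, rfl⟩
  · exact key H H₂ ht
  · have := (key (H.reverse h) (H₁.reverse h) (t := t.reverse) (s := u.reverse)
      (by simp [ht])).reverse h
    simpa using this

theorem InducedPath.isChain (H : InducedPath St l) : l.IsChain (fun x y => St (y - x)) := by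
  induction l with
  | nil => exact List.isChain_nil
  | cons x l ih =>
    rw [List.isChain_cons]
    refine ⟨fun y hy => (H [x] l rfl).step x (by simp) y hy, ih fun l₁ l₂ hl => ?_⟩
    have := H (x :: l₁) l₂ (by simp [hl])
    refine ⟨fun u hu w hw hN => ?_, fun u hu w hw => ?_⟩
    · obtain ⟨h1, h2⟩ := this.ends u (by simp [hu]) w hw hN
      rw [List.getLast?_cons_of_ne_nil (List.ne_nil_of_mem hu)] at h1
      exact ⟨h1, h2⟩
    · refine this.step u ?_ w hw
      rw [List.getLast?_cons_of_ne_nil (List.ne_nil_of_mem (List.mem_of_getLast? hu))]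
      exact hu

section Map

variable {St' : W → Prop} {φ : V →+ W}

theorem near_map (hφ : Function.Injective φ) (hSt : ∀ v, St' (φ v) ↔ St v) (v : V) :
    Near St' (φ v) ↔ Near St v := by
  simp [Near, hSt, map_eq_zero_iff φ hφ]

theorem apart_map (hφ : Function.Injective φ) (hSt : ∀ v, St' (φ v) ↔ St v) (v : V) :
    Apart St' (l₁.map φ) (l₂.map φ) (φ v) ↔ Apart St l₁ l₂ v := by
  simp only [Apart, List.forall_mem_map, ← map_sub, near_map hφ hSt]

theorem linked_map (hφ : Function.Injective φ) (hSt : ∀ v, St' (φ v) ↔ St v) :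
    Linked St' (l₁.map φ) (l₂.map φ) ↔ Linked St l₁ l₂ := by
  constructor
  · intro H
    refine ⟨fun x hx y hy hN => ?_, fun x hx y hy => ?_⟩
    · have := H.ends (φ x) (List.mem_map_of_mem hx) (φ y) (List.mem_map_of_mem hy) (by
        rwa [← map_sub, near_map hφ hSt])
      simpa [hφ.eq_iff] using this
    · have := H.step (φ x) (by simpa [hφ.eq_iff] using hx) (φ y) (by simpa [hφ.eq_iff] using hy)
      rwa [← map_sub, hSt] at this
  · intro H
    refine ⟨?_, ?_⟩
    · simp only [List.forall_mem_map, ← map_sub, near_map hφ hSt]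
      intro x hx y hy hN
      simpa [hφ.eq_iff] using H.ends x hx y hy hN
    · intro x hx y hy
      simp only [List.getLast?_map, List.head?_map, Option.mem_def, Option.map_eq_some_iff] at hx hy
      obtain ⟨x, hx, rfl⟩ := hx
      obtain ⟨y, hy, rfl⟩ := hy
      rw [← map_sub, hSt]
      exact H.step x hx y hy

theorem inducedPath_map (hφ : Function.Injective φ) (hSt : ∀ v, St' (φ v) ↔ St v) :
    InducedPath St' (l.map φ) ↔ InducedPath St l := by
  constructor
  · intro H l₁ l₂ hl
    exact (linked_map hφ hSt).1 (H _ _ (by simp [hl]))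
  · intro H l₁ l₂ hl
    obtain ⟨u, w, rfl, rfl, rfl⟩ := List.map_eq_append_iff.1 hl
    exact (linked_map hφ hSt).2 (H _ _ rfl)

end Map

theorem Linked.translate (H : Linked St l₁ l₂) (v : V) :
    Linked St (l₁.map (· + v)) (l₂.map (· + v)) where
  ends := by
    simp only [List.forall_mem_map, add_sub_add_right_eq_sub]
    intro x hx y hy hN
    simpa using H.ends x hx y hy hN
  step x hx y hy := by
    simp only [List.getLast?_map, List.head?_map, Option.mem_def, Option.map_eq_some_iff] at hx hy
    obtain ⟨x, hx, rfl⟩ := hx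
    obtain ⟨y, hy, rfl⟩ := hy
    simpa using H.step x hx y hy

theorem InducedPath.translate (H : InducedPath St l) (v : V) :
    InducedPath St (l.map (· + v)) := by
  intro l₁ l₂ hl
  obtain ⟨u, w, rfl, rfl, rfl⟩ := List.map_eq_append_iff.1 hl
  exact (H _ _ rfl).translate v

end InducedPath

/-! ### Cycles cut into eight paths -/

theorem fin8_induction {P : Fin 8 → Prop} (h0 : P 0) (h1 : P 1) (hs : ∀ i, P i → P (i + 2)) :
    ∀ i, P i := by
  have h2 := hs 0 h0
  have h3 := hs 1 h1
  have h4 := hs 2 h2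
  have h5 := hs 3 h3
  have h6 := hs 4 h4
  have h7 := hs 5 h5
  intro i
  fin_cases i <;> assumption

section Octagon

variable {V W : Type*} [AddCommGroup V] [AddCommGroup W]

/-- The combinatorial properties of the cycles `a⁰a¹…a⁷`. Here `St` describes the moves of the first
leaper and `ℓ` lists those of the second one, in counterclockwise order.

Apart from the junctions of consecutive paths, squares of distinct paths are never related by a move
of the first leaper. The `k`-th move of the second leaper carries the paths `k + 4` and `k + 5` onto
the paths `k` and `k + 1`, and it carries no other square of the cycle to a square of the cycle.
The field `apart_move` asks for more: if `x` is not on the paths `k + 4` and `k + 5`, and `y` is not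
on the paths `k` and `k + 1`, then `y` does not even differ by a move of the first leaper from the
image of `x`. The stronger property is the one that lifts preserve. -/
structure Octagon (St : V → Prop) (ℓ : Fin 8 → V) (a : Fin 8 → List V) : Prop where
  ne_nil : ∀ i, a i ≠ []
  path : ∀ i, InducedPath St (a i)
  link : ∀ i, Linked St (a i) (a (i + 1))
  apart : ∀ i d, d ≠ 0 → d ≠ 1 → d ≠ 7 → Apart St (a i) (a (i + d)) 0
  exchange : ∀ k, (a (k + 4) ++ a (k + 5)).map (· + ℓ k) = (a k ++ a (k + 1)).reverse
  apart_move : ∀ i d e, e ≠ 3 → e ≠ 4 → d ≠ e → d ≠ e + 1 →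
    Apart St (a i) (a (i + d)) (ℓ (i + e))

/-- An injective additive map `φ` that matches the moves of both leapers, the `k`-th move of the
second one going to the `(k + c)`-th, preserves and reflects the properties of an octagon. -/
theorem Octagon.map_iff {St : V → Prop} {St' : W → Prop} {ℓ : Fin 8 → V} {ℓ' : Fin 8 → W}
    {a : Fin 8 → List V} {a' : Fin 8 → List W} {φ : V →+ W} (hφ : Function.Injective φ)
    (hSt : ∀ v, St' (φ v) ↔ St v) (c : Fin 8) (hℓ : ∀ i, ℓ' (i + c) = φ (ℓ i))
    (ha : ∀ i, a' (i + c) = (a i).map φ) : Octagon St' ℓ' a' ↔ Octagon St ℓ a := by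
  have shift : ∀ i : Fin 8, ∃ j, i = j + c := fun i => ⟨i - c, by simp⟩
  have hex : ∀ k, (a' (k + c + 4) ++ a' (k + c + 5)).map (· + ℓ' (k + c)) =
      (a' (k + c) ++ a' (k + c + 1)).reverse ↔
      (a (k + 4) ++ a (k + 5)).map (· + ℓ k) = (a k ++ a (k + 1)).reverse := by
    intro k
    rw [add_right_comm k c 4, add_right_comm k c 5, add_right_comm k c 1, ha, ha, ha, ha, hℓ,
      ← (List.map_injective_iff.2 hφ).eq_iff]
    simp [Function.comp_def]
  constructor
  · intro H
    refine ⟨fun i h => H.ne_nil (i + c) (by simp [ha, h]), fun i => ?_, fun i => ?_, ?_, ?_, ?_⟩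
    · exact (inducedPath_map hφ hSt).1 (ha i ▸ H.path (i + c))
    · have := H.link (i + c)
      rw [add_right_comm, ha, ha] at this
      exact (linked_map hφ hSt).1 this
    · intro i d h0 h1 h7
      have := H.apart (i + c) d h0 h1 h7
      rw [add_right_comm, ha, ha, ← map_zero φ] at this
      exact (apart_map hφ hSt _).1 this
    · exact fun k => (hex k).1 (H.exchange (k + c))
    · intro i d e h1 h2 h3 h4
      have := H.apart_move (i + c) d e h1 h2 h3 h4
      rw [add_right_comm, add_right_comm i c e, ha, ha, hℓ] at this
      exact (apart_map hφ hSt _).1 this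
  · intro H
    refine ⟨fun i h => ?_, fun i => ?_, fun i => ?_, ?_, fun k => ?_, ?_⟩
    · obtain ⟨i, rfl⟩ := shift i
      exact H.ne_nil i (by simpa [ha] using h)
    · obtain ⟨i, rfl⟩ := shift i
      rw [ha]
      exact (inducedPath_map hφ hSt).2 (H.path i)
    · obtain ⟨i, rfl⟩ := shift i
      rw [add_right_comm, ha, ha]
      exact (linked_map hφ hSt).2 (H.link i)
    · intro i d h0 h1 h7
      obtain ⟨i, rfl⟩ := shift i
      rw [add_right_comm, ha, ha, ← map_zero φ]
      exact (apart_map hφ hSt _).2 (H.apart i d h0 h1 h7)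
    · obtain ⟨k, rfl⟩ := shift k
      exact (hex k).2 (H.exchange k)
    · intro i d e h1 h2 h3 h4
      obtain ⟨i, rfl⟩ := shift i
      rw [add_right_comm, add_right_comm i c e, ha, ha, hℓ]
      exact (apart_map hφ hSt _).2 (H.apart_move i d e h1 h2 h3 h4)

end Octagon

/-! ### Moves and symmetries in the plane -/

/-- The moves `(±r, ±s)` and `(±s, ±r)`; the signs of `r` and `s` do not matter. -/
def IsStep (r s : ℤ) (v : ℤ × ℤ) : Prop :=
  (v.1.natAbs = r.natAbs ∧ v.2.natAbs = s.natAbs) ∨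
    (v.1.natAbs = s.natAbs ∧ v.2.natAbs = r.natAbs)

theorem isStepSet {r s : ℤ} (hs : 0 < s) : IsStepSet (IsStep r s) where
  neg v h := by simpa [IsStep] using h
  zero h := by
    simp only [IsStep, Prod.fst_zero, Prod.snd_zero] at h
    omega

/-- The moves of a `(p, q)`-leaper, counterclockwise: the `k`-th one points between the directions
`k` and `k + 1` when `0 < p < q`. -/
def move (p q : ℤ) : Fin 8 → ℤ × ℤ :=
  ![(q, p), (p, q), (-p, q), (-q, p), (-q, -p), (-p, -q), (p, -q), (q, -p)]

/-- The rotation by a quarter turn. -/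
def rot : ℤ × ℤ →+ ℤ × ℤ := AddMonoidHom.mk' (fun v => (-v.2, v.1)) (by
  intro a b; ext <;> simp; ring)

/-- The reflection in the horizontal axis. -/
def flip : ℤ × ℤ →+ ℤ × ℤ := AddMonoidHom.mk' (fun v => (v.1, -v.2)) (by
  intro a b; ext <;> simp; ring)

/-- The rotation by an eighth of a turn followed by the homothety of ratio `√2`. -/
def turn : ℤ × ℤ →+ ℤ × ℤ := AddMonoidHom.mk' (fun v => (v.1 - v.2, v.1 + v.2)) (by
  intro a b; ext <;> simp <;> ring)

@[simp] theorem rot_apply (v : ℤ × ℤ) : rot v = (-v.2, v.1) := rfl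
@[simp] theorem flip_apply (v : ℤ × ℤ) : flip v = (v.1, -v.2) := rfl
@[simp] theorem turn_apply (v : ℤ × ℤ) : turn v = (v.1 - v.2, v.1 + v.2) := rfl

theorem rot_injective : Function.Injective rot := by
  rintro ⟨a, b⟩ ⟨c, d⟩ h
  simp at h ⊢
  omega

theorem flip_injective : Function.Injective flip := by
  rintro ⟨a, b⟩ ⟨c, d⟩ h
  simp at h ⊢
  omega

theorem turn_injective : Function.Injective turn := by
  rintro ⟨a, b⟩ ⟨c, d⟩ h
  simp at h ⊢
  omega

theorem isStep_rot {r s : ℤ} (v : ℤ × ℤ) : IsStep r s (rot v) ↔ IsStep r s v := by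
  simp only [IsStep, rot_apply]
  omega

theorem isStep_flip {r s : ℤ} (v : ℤ × ℤ) : IsStep r s (flip v) ↔ IsStep r s v := by
  simp only [IsStep, flip_apply]
  omega

theorem isStep_turn {r s : ℤ} (v : ℤ × ℤ) : IsStep (s - r) (r + s) (turn v) ↔ IsStep r s v := by
  simp only [IsStep, turn_apply, Int.natAbs_eq_natAbs_iff]
  constructor
  · rintro (⟨h1 | h1, h2 | h2⟩ | ⟨h1 | h1, h2 | h2⟩) <;> omega
  · rintro (⟨h1 | h1, h2 | h2⟩ | ⟨h1 | h1, h2 | h2⟩) <;> omega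

theorem move_add_two (p q : ℤ) (k : Fin 8) : move p q (k + 2) = rot (move p q k) := by
  fin_cases k <;> simp [move]

theorem move_flip (p q : ℤ) (k : Fin 8) : flip (move p q k) = move p q (-k - 1) := by
  fin_cases k <;> ext <;> simp [move] <;> rfl

theorem move_neg (p q : ℤ) (k : Fin 8) : -move p q k = move p q (k + 4) := by
  fin_cases k <;> simp [move]

theorem move_turn (p q : ℤ) (k : Fin 8) :
    move (q - p) (q + p) (k + 1) = turn (move p q k) := by
  fin_cases k <;> simp [move] <;> ring_nf <;> trivial

/-- The cycle is mapped to itself by the symmetries of the board that fix its center. -/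
structure Symmetric (a : OctCycle) : Prop where
  rot : ∀ i, a (i + 2) = (a i).map rot
  flip : ∀ i, a (-i) = ((a i).map flip).reverse

namespace Symmetric

variable {a : OctCycle} {r s p q : ℤ}

theorem apart_rot (S : Symmetric a) {i j : Fin 8} {v : ℤ × ℤ}
    (h : Apart (IsStep r s) (a i) (a j) v) :
    Apart (IsStep r s) (a (i + 2)) (a (j + 2)) (LeaperCycle.rot v) := by
  rw [S.rot, S.rot]
  exact (apart_map rot_injective isStep_rot v).2 h

theorem apart_flip (S : Symmetric a) {i j : Fin 8} {v : ℤ × ℤ}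
    (h : Apart (IsStep r s) (a i) (a j) v) :
    Apart (IsStep r s) (a (-i)) (a (-j)) (LeaperCycle.flip v) := by
  rw [S.flip, S.flip]
  have := (apart_map flip_injective isStep_flip v).2 h
  intro x hx y hy
  exact this x (List.mem_reverse.1 hx) y (List.mem_reverse.1 hy)

theorem linked_rot (S : Symmetric a) {i j : Fin 8} (h : Linked (IsStep r s) (a i) (a j)) :
    Linked (IsStep r s) (a (i + 2)) (a (j + 2)) := by
  rw [S.rot, S.rot]
  exact (linked_map rot_injective isStep_rot).2 h

theorem linked_flip (S : Symmetric a) (hs : 0 < s) {i j : Fin 8}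
    (h : Linked (IsStep r s) (a i) (a j)) : Linked (IsStep r s) (a (-j)) (a (-i)) := by
  rw [S.flip, S.flip]
  exact ((linked_map flip_injective isStep_flip).2 h).reverse (isStepSet hs)

theorem mem_rot (S : Symmetric a) {i : Fin 8} {x : ℤ × ℤ} :
    x ∈ a (i + 2) ↔ (x.2, -x.1) ∈ a i := by
  rw [S.rot, List.mem_map]
  constructor
  · rintro ⟨y, hy, rfl⟩
    simpa using hy
  · exact fun h => ⟨_, h, by simp⟩

theorem mem_flip (S : Symmetric a) {i : Fin 8} {x : ℤ × ℤ} :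
    x ∈ a (-i) ↔ (x.1, -x.2) ∈ a i := by
  rw [S.flip, List.mem_reverse, List.mem_map]
  constructor
  · rintro ⟨y, hy, rfl⟩
    simpa using hy
  · exact fun h => ⟨_, h, by simp⟩

/-- By symmetry, the images of all pairs of consecutive paths under the moves of the second leaper
are determined by one of them. -/
theorem exchange (S : Symmetric a)
    (h : (a 7 ++ a 0).map (· + move p q 3) = (a 3 ++ a 4).reverse) (k : Fin 8) :
    (a (k + 4) ++ a (k + 5)).map (· + move p q k) = (a k ++ a (k + 1)).reverse := by
  have hrot : ∀ k, (a (k + 4) ++ a (k + 5)).map (· + move p q k) = (a k ++ a (k + 1)).reverse →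
      (a (k + 2 + 4) ++ a (k + 2 + 5)).map (· + move p q (k + 2)) =
        (a (k + 2) ++ a (k + 2 + 1)).reverse := by
    intro k h
    rw [add_right_comm k 2 4, add_right_comm k 2 5, add_right_comm k 2 1, S.rot, S.rot, S.rot,
      S.rot, move_add_two, ← List.map_append, ← List.map_append, ← List.map_reverse, ← h]
    simp [Function.comp_def]
    grind
  have h5 := hrot 3 h
  have h7 := hrot 5 h5
  have h1 := hrot 7 h7
  have h4 : (a 0 ++ a 1).map (· + move p q 4) = (a 4 ++ a 5).reverse := by
    have e0 : a 0 ++ a 1 = ((a 7 ++ a 0).map LeaperCycle.flip).reverse := by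
      rw [List.map_append, List.reverse_append]
      exact congrArg₂ _ (S.flip 0) (S.flip 7)
    have e4 : a 4 ++ a 5 = ((a 3 ++ a 4).map LeaperCycle.flip).reverse := by
      rw [List.map_append, List.reverse_append]
      exact congrArg₂ _ (S.flip 4) (S.flip 3)
    rw [e0, e4, List.reverse_reverse, ← List.reverse_reverse (a 3 ++ a 4), ← h, List.map_reverse,
      List.map_reverse, List.map_map, List.map_map]
    congr 2
    funext x
    simp [move]
    ring
  have h6 := hrot 4 h4
  have h0 := hrot 6 h6
  exact fin8_induction (P := fun k => (a (k + 4) ++ a (k + 5)).map (· + move p q k) =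
    (a k ++ a (k + 1)).reverse) h0 h1 hrot k

end Symmetric

/-! ### Where the eight paths lie -/

/-- The relations between the proportions `r`, `s` of the first leaper, the proportions `p`, `q` of
the second one, and the number `J` that measures the size of a board. The proportion `r` may be
negative and may exceed `s`. The numbers `m` and `n` bound the moves of the first leaper, as in
`Small`; they replace absolute values and maxima, so that all relations are linear.

There are three regimes. In the general one, `c = 1`, the moves of the first leaper are short in
comparison with those of the second one. The regime `c = 2` is that of the boards obtained from an
initial cycle with `s ≤ r` by `f`-lifts alone, and `c = 3` that of the boards obtained from an
initial cycle with `r ≤ 0` by `g`-lifts alone. In the special regimes `m ≤ p` or `n ≤ q - p` may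
fail, and the position of the paths has to be known more precisely. -/
def Params (c J m n r s p q : ℤ) : Prop :=
  0 < s ∧ 0 < r + s ∧ 0 < p ∧ p < q ∧ 0 ≤ J ∧ r ≤ m ∧ -r ≤ m ∧ s ≤ m ∧ r + s ≤ n ∧ s - r ≤ n ∧
  ((c = 1 ∧ m ≤ p ∧ n ≤ q - p) ∨
    (c = 2 ∧ p = s ∧ q = r + 2 * s + 2 * J ∧ s ≤ r ∧ m = r ∧ n = r + s) ∨
    (c = 3 ∧ p = s + J ∧ q = r + 2 * s + J ∧ r ≤ 0 ∧ m = s ∧ n = s - r))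

/-- Where the square `(x, y)` of the path of direction E lies, in each of the three regimes: in a
polygon, in a rectangle of whose horizontal sides only the right ends are allowed, and at a point.
-/
def EastRegion (c J r s p q x y : ℤ) : Prop :=
  (c = 1 → y < x ∧ -y < x ∧ x < q ∧ x + y < p + q ∧ x - y < p + q ∧ y < q - p ∧ -y < q - p ∧
    2 * y < q ∧ -(2 * y) < q ∧ 2 * (x + y) < 3 * q - p ∧ 2 * (x - y) < 3 * q - p) ∧
  (c = 2 → -J ≤ y ∧ y ≤ J ∧ J + s ≤ x ∧ x ≤ r + s + J ∧
    (r + s + J ≤ x ∨ -J < y ∧ y < J)) ∧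
  (c = 3 → y = 0 ∧ x = r + s + J)

/-- Where the square `(x, y)` of the path of direction NE lies, in each of the three regimes. The
map `turn` exchanges the last two regimes, and the roles of this region and of `EastRegion`. -/
def NortheastRegion (c J r s p q x y : ℤ) : Prop :=
  (c = 1 → 0 < x ∧ 0 < y ∧ x < q ∧ y < q ∧ x + y < p + q ∧ x - y < 2 * p ∧ y - x < 2 * p ∧
    2 * (x - y) < p + q ∧ 2 * (y - x) < p + q ∧ 2 * x < 2 * p + q ∧ 2 * y < 2 * p + q) ∧
  (c = 2 → x = J + s ∧ y = J + s) ∧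
  (c = 3 → x - y ≤ J ∧ y - x ≤ J ∧ r + s + J ≤ x + y ∧ x + y ≤ 2 * s + J ∧
    (2 * s + J ≤ x + y ∨ x - y < J ∧ y - x < J))

/-- Where the squares of the `i`-th path lie: the regions of the directions other than E and NE are
obtained by quarter turns. -/
def Region (c J r s p q : ℤ) (i : Fin 8) (v : ℤ × ℤ) : Prop :=
  match i with
  | 0 => EastRegion c J r s p q v.1 v.2
  | 1 => NortheastRegion c J r s p q v.1 v.2
  | 2 => EastRegion c J r s p q v.2 (-v.1)
  | 3 => NortheastRegion c J r s p q v.2 (-v.1)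
  | 4 => EastRegion c J r s p q (-v.1) (-v.2)
  | 5 => NortheastRegion c J r s p q (-v.1) (-v.2)
  | 6 => EastRegion c J r s p q (-v.2) v.1
  | 7 => NortheastRegion c J r s p q (-v.2) v.1

/-- The cycle is symmetric, and its paths lie in the regions that the regime prescribes. In the
regime `c = 2`, moreover, squares of the path of direction E whose ordinates differ by `s` have
abscissas with a prescribed sum; this is needed to separate opposite paths in the next lift. The
regime `c = 3` has the image of this condition under `turn`. -/
structure Shape (c J r s p q : ℤ) (a : OctCycle) : Prop extends Symmetric a where
  east : ∀ x ∈ a 0, EastRegion c J r s p q x.1 x.2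
  northeast : ∀ x ∈ a 1, NortheastRegion c J r s p q x.1 x.2
  east_pair : c = 2 → ∀ x ∈ a 0, ∀ y ∈ a 0, y.2 - x.2 = s → x.1 + y.1 = r + 2 * s + 2 * J
  northeast_pair : c = 3 → ∀ x ∈ a 1, ∀ y ∈ a 1, (y.1 - y.2) - (x.1 - x.2) = r + s →
    (x.1 + x.2) + (y.1 + y.2) = r + 3 * s + 2 * J

variable {c J m n r s p q : ℤ} {a : OctCycle}

theorem Shape.mem_region (S : Shape c J r s p q a) (i : Fin 8) :
    ∀ x ∈ a i, Region c J r s p q i x := by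
  revert i
  have h2 : ∀ i, ∀ x ∈ a (i + 2), (x.2, -x.1) ∈ a i := fun i x hx => S.mem_rot.1 hx
  intro i
  fin_cases i
  · exact S.east
  · exact S.northeast
  · exact fun x hx => S.east _ (h2 0 x hx)
  · exact fun x hx => S.northeast _ (h2 1 x hx)
  · exact fun x hx => S.east _ (h2 0 _ (h2 2 x hx))
  · exact fun x hx => S.northeast _ (h2 1 _ (h2 3 x hx))
  · intro x hx
    have := S.east _ (h2 0 _ (h2 2 _ (h2 4 x hx)))
    show EastRegion c J r s p q (-x.2) x.1
    simpa using this
  · intro x hx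
    have := S.northeast _ (h2 1 _ (h2 3 _ (h2 5 x hx)))
    show NortheastRegion c J r s p q (-x.2) x.1
    simpa using this

/-- The octagon `|u|, |v| ≤ m`, `|u| + |v| ≤ n`, which contains the moves of the first leaper. -/
def Small (m n u v : ℤ) : Prop :=
  u ≤ m ∧ -u ≤ m ∧ v ≤ m ∧ -v ≤ m ∧ u + v ≤ n ∧ u - v ≤ n ∧ v - u ≤ n ∧ -u - v ≤ n

theorem Params.small (P : Params c J m n r s p q) {v : ℤ × ℤ} (h : Near (IsStep r s) v) :
    Small m n v.1 v.2 := by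
  obtain ⟨h1, h2, -, -, -, h3, h4, h5, h6, h7, -⟩ := P
  unfold Small
  rcases h with rfl | h
  · simp only [Prod.fst_zero, Prod.snd_zero]
    omega
  · simp only [IsStep, Int.natAbs_eq_natAbs_iff] at h
    rcases h with ⟨h | h, h' | h'⟩ | ⟨h | h, h' | h'⟩ <;> omega

namespace Symmetric

theorem apart_zero_rot (S : Symmetric a) {i j : Fin 8}
    (h : Apart (IsStep r s) (a i) (a j) 0) : Apart (IsStep r s) (a (i + 2)) (a (j + 2)) 0 := by
  have := S.apart_rot h
  rwa [map_zero] at this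

theorem apart_zero_flip (S : Symmetric a) {i j : Fin 8}
    (h : Apart (IsStep r s) (a i) (a j) 0) : Apart (IsStep r s) (a (-i)) (a (-j)) 0 := by
  have := S.apart_flip h
  rwa [map_zero] at this

theorem apart_move_rot (S : Symmetric a) {i j k : Fin 8}
    (h : Apart (IsStep r s) (a i) (a j) (move p q k)) :
    Apart (IsStep r s) (a (i + 2)) (a (j + 2)) (move p q (k + 2)) := by
  rw [move_add_two]
  exact S.apart_rot h

theorem apart_move_flip (S : Symmetric a) {i j k : Fin 8}
    (h : Apart (IsStep r s) (a i) (a j) (move p q k)) :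
    Apart (IsStep r s) (a (-i)) (a (-j)) (move p q (-k - 1)) := by
  rw [← move_flip]
  exact S.apart_flip h

end Symmetric

theorem apart_move_symm (hs : 0 < s) {i j k : Fin 8}
    (h : Apart (IsStep r s) (a i) (a j) (move p q k)) :
    Apart (IsStep r s) (a j) (a i) (move p q (k + 4)) := by
  rw [← move_neg]
  exact h.symm (isStepSet hs)

theorem apart_zero_symm (hs : 0 < s) {i j : Fin 8}
    (h : Apart (IsStep r s) (a i) (a j) 0) : Apart (IsStep r s) (a j) (a i) 0 := by
  simpa using h.symm (isStepSet hs)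

theorem forall_fin8 {P : Fin 8 → Prop} (h0 : P 0) (h1 : P 1) (h2 : P 2) (h3 : P 3) (h4 : P 4)
    (h5 : P 5) (h6 : P 6) (h7 : P 7) : ∀ i, P i := by
  intro i
  fin_cases i <;> assumption

set_option maxHeartbeats 4000000 in
/-- The condition `Octagon.apart_move` for the path of direction E follows from the position of the
paths, except for the listed pairs in the general regime. -/
theorem Shape.apart_move_east (P : Params c J m n r s p q) (S : Shape c J r s p q a)
    (d e : Fin 8) (e3 : e ≠ 3) (e4 : e ≠ 4) (de : d ≠ e) (de1 : d ≠ e + 1)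
    (hc : c = 1 → (d, e) ∉ [((0 : Fin 8), (1 : Fin 8)), (0, 2), (0, 5), (0, 6), (1, 2), (7, 5)]) :
    Apart (IsStep r s) (a 0) (a (0 + d)) (move p q (0 + e)) := by
  rintro ⟨x, y⟩ hx ⟨z, w⟩ hy hN
  have gx := S.mem_region _ _ hx
  have gy := S.mem_region _ _ hy
  have hS := P.small hN
  clear hN hx hy S
  rw [zero_add] at gy hS
  obtain ⟨h1, h2, h3, h4, h5, h6, h7, h8, h9, h10, ⟨rfl, P⟩ | ⟨rfl, P⟩ | ⟨rfl, P⟩⟩ := P <;>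
  simp only [Region, EastRegion, Int.reduceEq, false_imp_iff, true_imp_iff, true_and,
    and_true] at gx <;>
  revert e3 e4 de de1 hc gy hS <;>
  revert d e <;>
  refine forall_fin8 ?_ ?_ ?_ ?_ ?_ ?_ ?_ ?_ <;>
  refine forall_fin8 ?_ ?_ ?_ ?_ ?_ ?_ ?_ ?_ <;>
  intro e3 e4 de de1 hS hc gy <;>
  first
  | exact absurd rfl e3
  | exact absurd rfl e4
  | exact absurd rfl de
  | exact absurd rfl de1
  | exact absurd (by decide) (hc rfl)
  | clear e3 e4 de de1 hc
    simp only [Region, EastRegion, NortheastRegion, Int.reduceEq, false_imp_iff, true_imp_iff,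
      true_and, and_true] at gy
    simp only [Small, move, Prod.fst_sub, Prod.snd_sub, Matrix.cons_val] at hS
    omega

set_option maxHeartbeats 4000000 in
/-- The condition `Octagon.apart_move` for the path of direction NE follows from the position of the
paths, except for the listed pairs in the general regime. -/
theorem Shape.apart_move_northeast (P : Params c J m n r s p q) (S : Shape c J r s p q a)
    (d e : Fin 8) (e3 : e ≠ 3) (e4 : e ≠ 4) (de : d ≠ e) (de1 : d ≠ e + 1)
    (hc : c = 1 → (d, e) ∉ [((7 : Fin 8), (5 : Fin 8)), (0, 1), (0, 2), (0, 5), (0, 6), (1, 2)]) :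
    Apart (IsStep r s) (a 1) (a (1 + d)) (move p q (1 + e)) := by
  rintro ⟨x, y⟩ hx ⟨z, w⟩ hy hN
  have gx := S.mem_region _ _ hx
  have gy := S.mem_region _ _ hy
  have hS := P.small hN
  clear hN hx hy S
  obtain ⟨h1, h2, h3, h4, h5, h6, h7, h8, h9, h10, ⟨rfl, P⟩ | ⟨rfl, P⟩ | ⟨rfl, P⟩⟩ := P <;>
  simp only [Region, NortheastRegion, Int.reduceEq, false_imp_iff, true_imp_iff, true_and,
    and_true] at gx <;>
  revert e3 e4 de de1 hc gy hS <;>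
  revert d e <;>
  refine forall_fin8 ?_ ?_ ?_ ?_ ?_ ?_ ?_ ?_ <;>
  refine forall_fin8 ?_ ?_ ?_ ?_ ?_ ?_ ?_ ?_ <;>
  intro e3 e4 de de1 hS hc gy <;>
  first
  | exact absurd rfl e3
  | exact absurd rfl e4
  | exact absurd rfl de
  | exact absurd rfl de1
  | exact absurd (by decide) (hc rfl)
  | clear e3 e4 de de1 hc
    simp only [Fin.reduceAdd, Region, EastRegion, NortheastRegion, Int.reduceEq, false_imp_iff,
      true_imp_iff, true_and, and_true] at gy
    simp only [Fin.reduceAdd, Small, move, Prod.fst_sub, Prod.snd_sub, Matrix.cons_val] at hS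
    omega

/-- The symmetries of the cycle, and the position of its paths, reduce the properties of an octagon
to a few pairs of paths. -/
theorem Octagon.of_representatives (P : Params c J m n r s p q) (S : Shape c J r s p q a)
    (ne0 : a 0 ≠ []) (ne1 : a 1 ≠ [])
    (path0 : InducedPath (IsStep r s) (a 0)) (path1 : InducedPath (IsStep r s) (a 1))
    (link : Linked (IsStep r s) (a 0) (a 1))
    (h02 : Apart (IsStep r s) (a 0) (a 2) 0) (h03 : Apart (IsStep r s) (a 0) (a 3) 0)
    (h04 : Apart (IsStep r s) (a 0) (a 4) 0) (h13 : Apart (IsStep r s) (a 1) (a 3) 0)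
    (h15 : Apart (IsStep r s) (a 1) (a 5) 0)
    (exch : (a 7 ++ a 0).map (· + move p q 3) = (a 3 ++ a 4).reverse)
    (h001 : c = 1 → Apart (IsStep r s) (a 0) (a 0) (move p q 1))
    (h012 : c = 1 → Apart (IsStep r s) (a 0) (a 1) (move p q 2))
    (h112 : c = 1 → Apart (IsStep r s) (a 1) (a 1) (move p q 2)) :
    Octagon (IsStep r s) (move p q) a := by
  have hs : 0 < s := P.1
  constructor
  · exact fin8_induction ne0 ne1 fun i h h' => h (by simpa [S.rot] using h')
  · exact fin8_induction path0 path1 fun i h => by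
      rw [S.rot]; exact (inducedPath_map rot_injective isStep_rot).2 h
  · refine fin8_induction link ?_ fun i h => ?_
    · exact S.linked_rot (S.linked_flip hs link)
    · rw [add_right_comm]
      exact S.linked_rot h
  · have h05 : Apart (IsStep r s) (a 0) (a 5) 0 := S.apart_zero_flip h03
    refine fin8_induction ?_ ?_ ?_
    · intro d
      fin_cases d <;> intro d0 d1 d7
      · exact absurd rfl d0
      · exact absurd rfl d1
      · exact h02
      · exact h03
      · exact h04
      · exact h05
      · exact S.apart_zero_flip h02
      · exact absurd rfl d7
    · intro d
      fin_cases d <;> intro d0 d1 d7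
      · exact absurd rfl d0
      · exact absurd rfl d1
      · exact h13
      · exact S.apart_zero_rot (S.apart_zero_rot (apart_zero_symm hs h05))
      · exact h15
      · exact apart_zero_symm hs (S.apart_zero_rot (S.apart_zero_rot (S.apart_zero_rot h03)))
      · exact S.apart_zero_rot (S.apart_zero_rot (S.apart_zero_rot (apart_zero_symm hs h13)))
      · exact absurd rfl d7
    · intro i h d d0 d1 d7
      have := S.apart_zero_rot (h d d0 d1 d7)
      rwa [add_right_comm] at this
  · exact S.exchange exch
  · refine fin8_induction ?_ ?_ ?_
    · intro d e e3 e4 de de1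
      by_cases hc : c = 1 → (d, e) ∉
          [((0 : Fin 8), (1 : Fin 8)), (0, 2), (0, 5), (0, 6), (1, 2), (7, 5)]
      · exact S.apart_move_east P d e e3 e4 de de1 hc
      · clear e3 e4 de de1
        simp only [List.mem_cons, Prod.mk.injEq, List.not_mem_nil, or_false, Classical.not_imp,
          not_not] at hc
        obtain ⟨hc, ⟨rfl, rfl⟩ | ⟨rfl, rfl⟩ | ⟨rfl, rfl⟩ | ⟨rfl, rfl⟩ | ⟨rfl, rfl⟩ | ⟨rfl, rfl⟩⟩ :=
          hc
        · exact h001 hc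
        · have := apart_move_symm hs (S.apart_move_flip (h001 hc))
          exact this
        · have := apart_move_symm hs (h001 hc)
          exact this
        · have := S.apart_move_flip (h001 hc)
          exact this
        · exact h012 hc
        · have := S.apart_move_flip (h012 hc)
          exact this
    · intro d e e3 e4 de de1
      by_cases hc : c = 1 → (d, e) ∉
          [((7 : Fin 8), (5 : Fin 8)), (0, 1), (0, 2), (0, 5), (0, 6), (1, 2)]
      · exact S.apart_move_northeast P d e e3 e4 de de1 hc
      · clear e3 e4 de de1
        simp only [List.mem_cons, Prod.mk.injEq, List.not_mem_nil, or_false, Classical.not_imp,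
          not_not] at hc
        obtain ⟨hc, ⟨rfl, rfl⟩ | ⟨rfl, rfl⟩ | ⟨rfl, rfl⟩ | ⟨rfl, rfl⟩ | ⟨rfl, rfl⟩ | ⟨rfl, rfl⟩⟩ :=
          hc
        · have := apart_move_symm hs (h012 hc)
          exact this
        · exact h112 hc
        · have := apart_move_symm hs (S.apart_move_rot (S.apart_move_flip (h112 hc)))
          exact this
        · have := apart_move_symm hs (h112 hc)
          exact this
        · have := S.apart_move_rot (S.apart_move_flip (h112 hc))
          exact this
        · have := S.apart_move_rot (S.apart_move_flip (apart_move_symm hs (h012 hc)))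
          exact this
    · intro i h d e e3 e4 de de1
      have := S.apart_move_rot (h d e e3 e4 de de1)
      rwa [add_right_comm, add_right_comm i e] at this

/-- The induction hypothesis for lifts: the cycle `a` has the shape that its regime prescribes, and
it is an octagon with respect to an `(r, s)`-leaper and a `(p, q)`-leaper. -/
structure State (c J m n r s p q : ℤ) (a : OctCycle) : Prop where
  params : Params c J m n r s p q
  shape : Shape c J r s p q a
  octagon : Octagon (IsStep r s) (move p q) a

theorem fin8_neg_add_one (i : Fin 8) : -(i + 1) = -(i + 2) + 1 := by
  revert i
  decide

theorem fin8_val_add_two (i : Fin 8) : ((i + 2 : Fin 8) : ℕ) % 2 = (i : ℕ) % 2 := by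
  revert i
  decide

theorem fin8_val_neg (i : Fin 8) : ((-i : Fin 8) : ℕ) % 2 = (i : ℕ) % 2 := by
  revert i
  decide

theorem dirVec_add_two (i : Fin 8) : dirVec (i + 2) = rot (dirVec i) := by
  revert i
  exact forall_fin8 rfl rfl rfl rfl rfl rfl rfl rfl

theorem dirVec_neg (i : Fin 8) : dirVec (-i) = flip (dirVec i) := by
  revert i
  exact forall_fin8 rfl rfl rfl rfl rfl rfl rfl rfl

/-! ### The eighth of a turn -/

/-- The image of a cycle under `turn`, with its paths renumbered accordingly. -/
def twist (a : OctCycle) : OctCycle := fun i => (a (i - 1)).map turn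

theorem twist_add_one (a : OctCycle) (i : Fin 8) : twist a (i + 1) = (a i).map turn := by
  simp [twist]

theorem turn_rot (v : ℤ × ℤ) : turn (rot v) = rot (turn v) := by
  ext <;> simp <;> ring

theorem turn_flip_rot (v : ℤ × ℤ) : turn (flip (rot v)) = flip (turn v) := by
  ext <;> simp; ring

theorem symmetric_twist_iff : Symmetric (twist a) ↔ Symmetric a := by
  have inj := List.map_injective_iff.2 turn_injective
  have hr : ∀ i, twist a (i + 1 + 2) = (twist a (i + 1)).map rot ↔ a (i + 2) = (a i).map rot := by
    intro i
    rw [add_right_comm, twist_add_one, twist_add_one, ← inj.eq_iff (a := a (i + 2))]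
    simp [Function.comp_def, -rot_apply, -turn_apply, turn_rot]
  have hf : ∀ i, a (i + 2) = (a i).map rot →
      (twist a (-(i + 1)) = ((twist a (i + 1)).map flip).reverse ↔
        a (-(i + 2)) = ((a (i + 2)).map flip).reverse) := by
    intro i h
    rw [h, fin8_neg_add_one, twist_add_one, twist_add_one, ← inj.eq_iff (a := a (-(i + 2)))]
    simp [Function.comp_def, -rot_apply, -turn_apply, -flip_apply, turn_flip_rot]
  constructor
  · intro S
    have R : ∀ i, a (i + 2) = (a i).map rot := fun i => (hr i).1 (S.rot _)
    refine ⟨R, fun i => ?_⟩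
    have := (hf (i - 2) (R _)).1 (S.flip _)
    rwa [sub_add_cancel] at this
  · intro S
    refine ⟨fun i => ?_, fun i => ?_⟩
    · have := (hr (i - 1)).2 (S.rot _)
      rwa [sub_add_cancel] at this
    · have := (hf (i - 1) (S.rot _)).2 (S.flip _)
      rwa [sub_add_cancel] at this

theorem octagon_twist_iff : Octagon (IsStep (s - r) (r + s)) (move (q - p) (q + p)) (twist a) ↔
    Octagon (IsStep r s) (move p q) a :=
  Octagon.map_iff turn_injective isStep_turn 1 (move_turn p q) (twist_add_one a)

/-- The map `turn` preserves the induction hypothesis; it exchanges the two special regimes. -/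
theorem State.twist (H : State c J m n r s p q a) :
    ∃ c' J' m' n', State c' J' m' n' (s - r) (r + s) (q - p) (q + p) (twist a) := by
  obtain ⟨P, S, O⟩ := H
  have e0 : LeaperCycle.twist a 0 = (a 7).map turn := twist_add_one a 7
  have e1 : LeaperCycle.twist a 1 = (a 0).map turn := twist_add_one a 0
  have h7 := S.mem_region 7
  have h0 := S.east
  have h71 : ∀ x ∈ a 7, (-x.2, x.1) ∈ a 1 := fun x hx => by
    simpa using (S.mem_rot (i := 1)).1 ((S.mem_rot (i := 3)).1 ((S.mem_rot (i := 5)).1 hx))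
  obtain ⟨h1, h2, h3, h4, h5, h6, h7', h8, h9, h10, ⟨rfl, P⟩ | ⟨rfl, P⟩ | ⟨rfl, P⟩⟩ := P
  · refine ⟨1, J, n, 2 * m, by unfold Params; omega, ⟨symmetric_twist_iff.2 S.toSymmetric,
      ?_, ?_, fun h => absurd h (by decide),
      fun h => absurd h (by decide)⟩, octagon_twist_iff.2 O⟩
    · rw [e0]
      simp only [List.forall_mem_map]
      intro x hx
      have := h7 x hx
      simp only [Region, EastRegion, NortheastRegion, turn_apply, Int.reduceEq, false_imp_iff,
        true_imp_iff, and_true] at this ⊢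
      omega
    · rw [e1]
      simp only [List.forall_mem_map]
      intro x hx
      have := h0 x hx
      simp only [EastRegion, NortheastRegion, turn_apply, Int.reduceEq, false_imp_iff,
        true_imp_iff, and_true] at this ⊢
      omega
  · refine ⟨3, 2 * J, n, 2 * m, by unfold Params; omega, ⟨symmetric_twist_iff.2 S.toSymmetric,
      ?_, ?_, fun h => absurd h (by decide), fun _ => ?_⟩, octagon_twist_iff.2 O⟩
    · rw [e0]
      simp only [List.forall_mem_map]
      intro x hx
      have := h7 x hx
      simp only [Region, EastRegion, NortheastRegion, turn_apply, Int.reduceEq, false_imp_iff,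
        true_imp_iff, and_true, true_and] at this ⊢
      omega
    · rw [e1]
      simp only [List.forall_mem_map]
      intro x hx
      have := h0 x hx
      simp only [EastRegion, NortheastRegion, turn_apply, Int.reduceEq, false_imp_iff,
        true_imp_iff, and_true, true_and] at this ⊢
      omega
    · rw [e1]
      simp only [List.forall_mem_map, turn_apply]
      intro x hx y hy h
      have := S.east_pair rfl y hy x hx
      omega
  · refine ⟨2, J, n, 2 * m, by unfold Params; omega, ⟨symmetric_twist_iff.2 S.toSymmetric,
      ?_, ?_, fun _ => ?_, fun h => absurd h (by decide)⟩, octagon_twist_iff.2 O⟩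
    · rw [e0]
      simp only [List.forall_mem_map]
      intro x hx
      have := h7 x hx
      simp only [Region, EastRegion, NortheastRegion, turn_apply, Int.reduceEq, false_imp_iff,
        true_imp_iff, and_true, true_and] at this ⊢
      omega
    · rw [e1]
      simp only [List.forall_mem_map]
      intro x hx
      have := h0 x hx
      simp only [EastRegion, NortheastRegion, turn_apply, Int.reduceEq, false_imp_iff,
        true_imp_iff, and_true, true_and] at this ⊢
      omega
    · rw [e0]
      simp only [List.forall_mem_map, turn_apply]
      intro x hx y hy h
      have := S.northeast_pair rfl _ (h71 y hy) _ (h71 x hx)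
      dsimp only at this
      omega

/-- The converse of `State.twist`, except for the regime `c = 3`: a lift of type `f` or `h` never
leads to it. -/
theorem State.of_twist (hc : c = 1 ∨ c = 2)
    (H : State c J m n (s - r) (r + s) (q - p) (q + p) (LeaperCycle.twist a)) :
    ∃ c' J' m' n', State c' J' m' n' r s p q a := by
  obtain ⟨P, S, O⟩ := H
  have h1 : ∀ x ∈ a 0, turn x ∈ LeaperCycle.twist a 1 := fun x hx => by
    rw [show LeaperCycle.twist a 1 = (a 0).map turn from twist_add_one a 0]
    exact List.mem_map_of_mem hx
  have h2 : ∀ x ∈ a 1, turn x ∈ LeaperCycle.twist a 2 := fun x hx => by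
    rw [show LeaperCycle.twist a 2 = (a 1).map turn from twist_add_one a 1]
    exact List.mem_map_of_mem hx
  have S2 := S.mem_region 2
  have S1 := S.northeast
  rcases hc with rfl | rfl
  · refine ⟨1, J, n / 2, m, ?_, ⟨symmetric_twist_iff.1 S.toSymmetric, ?_, ?_,
      fun h => absurd h (by decide), fun h => absurd h (by decide)⟩, octagon_twist_iff.1 O⟩
    · unfold Params at P ⊢
      omega
    · intro x hx
      have := S1 _ (h1 x hx)
      simp only [EastRegion, NortheastRegion, turn_apply, Int.reduceEq, false_imp_iff,
        true_imp_iff, and_true] at this ⊢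
      omega
    · intro x hx
      have := S2 _ (h2 x hx)
      simp only [Region, EastRegion, NortheastRegion, turn_apply, Int.reduceEq, false_imp_iff,
        true_imp_iff, and_true] at this ⊢
      omega
  · unfold Params at P
    refine ⟨3, J, n / 2, m, ?_, ⟨symmetric_twist_iff.1 S.toSymmetric, ?_, ?_,
      fun h => absurd h (by decide), fun _ => ?_⟩, octagon_twist_iff.1 O⟩
    · unfold Params
      omega
    · intro x hx
      have := S1 _ (h1 x hx)
      simp only [EastRegion, NortheastRegion, turn_apply, Int.reduceEq, false_imp_iff,
        true_imp_iff, and_true, true_and] at this ⊢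
      omega
    · intro x hx
      have := S2 _ (h2 x hx)
      simp only [Region, EastRegion, NortheastRegion, turn_apply, Int.reduceEq, false_imp_iff,
        true_imp_iff, and_true, true_and] at this ⊢
      omega
    · intro x hx y hy h
      have := S.east_pair rfl _ (S.mem_rot.1 (h2 y hy)) _ (S.mem_rot.1 (h2 x hx))
      simp only [turn_apply] at this
      omega

/-! ### The initial cycles -/

/-- The cycle of eight one-square paths that is the initial cycle for the proportions `p`, `q` of
the second leaper. -/
def baseCycle (p q : ℤ) : OctCycle := fun i =>
  if (i : ℕ) % 2 = 0 then [(q - p) • dirVec i] else [p • dirVec i]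

theorem symmetric_baseCycle (p q : ℤ) : Symmetric (baseCycle p q) := by
  constructor <;> intro i
  · simp only [baseCycle, fin8_val_add_two, dirVec_add_two]
    split_ifs <;> simp only [List.map_cons, List.map_nil, map_zsmul]
  · simp only [baseCycle, fin8_val_neg, dirVec_neg]
    split_ifs <;> simp only [List.map_cons, List.map_nil, map_zsmul, List.reverse_singleton]

theorem inducedPath_singleton {St : ℤ × ℤ → Prop} (x : ℤ × ℤ) : InducedPath St [x] := by
  intro l₁ l₂ h
  rcases List.singleton_eq_append_iff.1 h with ⟨rfl, rfl⟩ | ⟨rfl, rfl⟩ <;>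
    constructor <;> simp

theorem State.base (hs : 0 < s) (hrs : 0 < r + s) :
    ∃ c J m n, State c J m n r s s (r + 2 * s) (baseCycle s (r + 2 * s)) := by
  obtain ⟨c, m, n, P, hc⟩ : ∃ c m n, Params c 0 m n r s s (r + 2 * s) ∧
      (c = 1 ∧ m = s ∧ n = r + s ∧ 0 ≤ r ∧ r ≤ s ∨ c = 2 ∧ m = r ∧ n = r + s ∧ s ≤ r ∨
        c = 3 ∧ m = s ∧ n = s - r ∧ r ≤ 0) := by
    unfold Params
    by_cases h1 : s ≤ r
    · exact ⟨2, r, r + s, by omega⟩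
    · by_cases h2 : r ≤ 0
      · exact ⟨3, s, s - r, by omega⟩
      · exact ⟨1, s, r + s, by omega⟩
  suffices H : Shape c 0 r s s (r + 2 * s) (baseCycle s (r + 2 * s)) ∧
      Octagon (IsStep r s) (move s (r + 2 * s)) (baseCycle s (r + 2 * s)) from
    ⟨c, 0, m, n, P, H.1, H.2⟩
  set a := baseCycle s (r + 2 * s) with ha
  have e0 : a 0 = [(r + s, 0)] := by simp [ha, baseCycle, dirVec]; ring
  have e1 : a 1 = [(s, s)] := by simp [ha, baseCycle, dirVec]
  have e2 : a 2 = [(0, r + s)] := by simp [ha, baseCycle, dirVec]; ring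
  have e3 : a 3 = [(-s, s)] := by simp [ha, baseCycle, dirVec]
  have e4 : a 4 = [(-r - s, 0)] := by simp [ha, baseCycle, dirVec]; ring
  have e5 : a 5 = [(-s, -s)] := by simp [ha, baseCycle, dirVec]
  have e7 : a 7 = [(s, -s)] := by simp [ha, baseCycle, dirVec]
  have S : Shape c 0 r s s (r + 2 * s) a := by
    refine ⟨symmetric_baseCycle _ _, ?_, ?_, ?_, ?_⟩
    · simp only [e0, List.forall_mem_singleton, EastRegion, true_and]
      rcases hc with ⟨rfl, rfl, rfl, hc⟩ | ⟨rfl, rfl, rfl, hc⟩ | ⟨rfl, rfl, rfl, hc⟩ <;> omega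
    · simp only [e1, List.forall_mem_singleton, NortheastRegion]
      rcases hc with ⟨rfl, rfl, rfl, hc⟩ | ⟨rfl, rfl, rfl, hc⟩ | ⟨rfl, rfl, rfl, hc⟩ <;> omega
    · simp only [e0, List.forall_mem_singleton]
      omega
    · simp only [e1, List.forall_mem_singleton]
      omega
  have geo : ∀ (x y v : ℤ × ℤ), ¬ (y.1 - x.1 - v.1 = 0 ∧ y.2 - x.2 - v.2 = 0) →
      ¬ IsStep r s (y.1 - x.1 - v.1, y.2 - x.2 - v.2) → Apart (IsStep r s) [x] [y] v := by
    intro x y v h0 h1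
    simp only [Apart, List.forall_mem_singleton]
    rintro (h | h)
    · exact h0 (by simpa [Prod.ext_iff] using h)
    · exact h1 h
  refine ⟨S, Octagon.of_representatives P S (by simp [e0]) (by simp [e1])
    (e0 ▸ inducedPath_singleton _) (e1 ▸ inducedPath_singleton _) ?_ ?_ ?_ ?_ ?_ ?_ ?_ ?_ ?_ ?_⟩
  · rw [e0, e1]
    have : IsStep r s ((s, s) - (r + s, 0)) := by simp [IsStep]
    constructor <;> simp_all
  · rw [e0, e2]
    refine geo _ _ _ ?_ ?_
    all_goals
      simp only [IsStep, Prod.fst_zero, Prod.snd_zero]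
      omega
  · rw [e0, e3]
    refine geo _ _ _ ?_ ?_
    all_goals
      simp only [IsStep, Prod.fst_zero, Prod.snd_zero]
      omega
  · rw [e0, e4]
    refine geo _ _ _ ?_ ?_
    all_goals
      simp only [IsStep, Prod.fst_zero, Prod.snd_zero]
      omega
  · rw [e1, e3]
    refine geo _ _ _ ?_ ?_
    all_goals
      simp only [IsStep, Prod.fst_zero, Prod.snd_zero]
      omega
  · rw [e1, e5]
    refine geo _ _ _ ?_ ?_
    all_goals
      simp only [IsStep, Prod.fst_zero, Prod.snd_zero]
      omega
  · rw [e7, e0, e3, e4]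
    simp [move]
    ring_nf
    simp
  · intro h
    rw [e0]
    refine geo _ _ _ ?_ ?_
    all_goals
      simp only [IsStep, move, Matrix.cons_val]
      omega
  · intro h
    rw [e0, e1]
    refine geo _ _ _ ?_ ?_
    all_goals
      simp only [IsStep, move, Matrix.cons_val]
      omega
  · intro h
    rw [e1]
    refine geo _ _ _ ?_ ?_
    all_goals
      simp only [IsStep, move, Matrix.cons_val]
      omega

/-! ### Pairs of paths -/

/-- The position of the paths alone excludes steps from the `i`-th path displaced by `(u, w)` to the
`j`-th path. -/
def Clear (c J m n r s p q : ℤ) (i j : Fin 8) (u w : ℤ) : Prop :=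
  ∀ x y z t, Region c J r s p q i (x, y) → Region c J r s p q j (z, t) →
    ¬ Small m n (z - x - u) (t - y - w)

theorem State.apart_of_clear (H : State c J m n r s p q a) {i j : Fin 8} {u w : ℤ}
    (h : Clear c J m n r s p q i j u w) : Apart (IsStep r s) (a i) (a j) (u, w) :=
  fun x hx y hy hN =>
    h x.1 x.2 y.1 y.2 (H.shape.mem_region i x hx) (H.shape.mem_region j y hy) (H.params.small hN)

section Octagon

variable {V : Type*} [AddCommGroup V] {St : V → Prop} {ℓ : Fin 8 → V} {a : Fin 8 → List V}

theorem Octagon.apart' (O : Octagon St ℓ a) {i j : Fin 8} (h : i ≠ j ∧ j ≠ i + 1 ∧ i ≠ j + 1) :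
    Apart St (a i) (a j) 0 := by
  have := O.apart i (j - i) (by grind) (by grind) (by grind)
  rwa [add_sub_cancel] at this

theorem Octagon.apart_move' (O : Octagon St ℓ a) {i j k : Fin 8}
    (h : i ≠ k + 4 ∧ i ≠ k + 5 ∧ j ≠ k ∧ j ≠ k + 1) : Apart St (a i) (a j) (ℓ k) := by
  obtain ⟨h1, h2, h3, h4⟩ := h
  have e3 : ∀ i k : Fin 8, i ≠ k + 5 → k - i ≠ 3 := by decide
  have e4 : ∀ i k : Fin 8, i ≠ k + 4 → k - i ≠ 4 := by decide
  have := O.apart_move i (j - i) (k - i) (e3 i k h2) (e4 i k h1) (by grind) (by grind)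
  rwa [add_sub_cancel, add_sub_cancel] at this

theorem Octagon.add_mem (O : Octagon St ℓ a) (k : Fin 8) {x : V}
    (hx : x ∈ a (k + 4) ∨ x ∈ a (k + 5)) : x + ℓ k ∈ a k ∨ x + ℓ k ∈ a (k + 1) := by
  have : x + ℓ k ∈ (a k ++ a (k + 1)).reverse := by
    rw [← O.exchange k]
    exact List.mem_map_of_mem (f := (· + ℓ k)) (List.mem_append.2 hx)
  simpa [or_comm] using this

/-- The exchange by the `k`-th move carries the first square of the path `k + 4` to the last one of
the path `k + 1`. -/
theorem Octagon.head_iff (O : Octagon St ℓ a) (k : Fin 8) (x : V) :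
    x ∈ (a (k + 4)).head? ↔ x + ℓ k ∈ (a (k + 1)).getLast? := by
  have h := congrArg List.head? (O.exchange k)
  rw [List.head?_reverse, List.getLast?_append_of_ne_nil _ (O.ne_nil _), List.head?_map,
    List.head?_append_of_ne_nil _ (O.ne_nil _)] at h
  rw [← h]
  simp

end Octagon

theorem Apart.sub {V : Type*} [AddCommGroup V] {St : V → Prop} {l₁ l₂ : List V} {v : V}
    (h : Apart St l₁ l₂ v) {x y w : V} (hx : x ∈ l₁) (hy : y ∈ l₂) (hw : w = y - x - v) :
    ¬ Near St w := hw ▸ h x hx y hy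

section Apart

variable {V : Type*} [AddCommGroup V] {St : V → Prop} {l l₁ l₂ : List V} {u v w : V}

theorem apart_append_left : Apart St (l₁ ++ l₂) l v ↔ Apart St l₁ l v ∧ Apart St l₂ l v := by
  simp only [Apart, List.forall_mem_append]

theorem apart_append_right : Apart St l (l₁ ++ l₂) v ↔ Apart St l l₁ v ∧ Apart St l l₂ v := by
  simp only [Apart, List.forall_mem_append, forall_and]

theorem apart_reverse_left : Apart St l₁.reverse l₂ v ↔ Apart St l₁ l₂ v := by
  simp only [Apart, List.mem_reverse]

theorem apart_reverse_right : Apart St l₁ l₂.reverse v ↔ Apart St l₁ l₂ v := by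
  simp only [Apart, List.mem_reverse]

theorem apart_map_add :
    Apart St (l₁.map (· + u)) (l₂.map (· + w)) v ↔ Apart St l₁ l₂ (v + u - w) := by
  simp only [Apart, List.forall_mem_map]
  have : ∀ x y, y + w - (x + u) - v = y - x - (v + u - w) := fun x y => by abel
  simp only [this]

end Apart

section Exchange

variable {V : Type*} [AddCommGroup V] {St : V → Prop} {ℓ : Fin 8 → V} {a : Fin 8 → List V}

/-- Squares of the `i`-th path may be replaced by their images under a move of the second leaper,
when the displacement is changed accordingly. -/
theorem Octagon.exchange_left (O : Octagon St ℓ a) (k : Fin 8) {i : Fin 8} {l : List V} {v v' : V}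
    (hi : i = k + 4 ∨ i = k + 5) (hv : v - ℓ k = v') (h0 : Apart St (a k) l v')
    (h1 : Apart St (a (k + 1)) l v') : Apart St (a i) l v := by
  intro x hx y hy
  have e : y - x - v = y - (x + ℓ k) - v' := by rw [← hv]; abel
  rcases O.add_mem k (x := x) (by rcases hi with rfl | rfl <;> simp [hx]) with h | h
  · exact h0.sub h hy e
  · exact h1.sub h hy e

theorem Octagon.exchange_right (O : Octagon St ℓ a) (k : Fin 8) {j : Fin 8} {l : List V} {v v' : V}
    (hj : j = k + 4 ∨ j = k + 5) (hv : v + ℓ k = v') (h0 : Apart St l (a k) v')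
    (h1 : Apart St l (a (k + 1)) v') : Apart St l (a j) v := by
  intro x hx y hy
  have e : y - x - v = y + ℓ k - x - v' := by rw [← hv]; abel
  rcases O.add_mem k (x := y) (by rcases hj with rfl | rfl <;> simp [hy]) with h | h
  · exact h0.sub hx h e
  · exact h1.sub hx h e

end Exchange

/-- The analogue of `State.apart_of_clear` that uses the exact moves of the first leaper instead of
the bounds `Small`. -/
theorem State.apart_of_exact (H : State c J m n r s p q a) {i j : Fin 8} {u w : ℤ}
    (h : ∀ x y z t, Region c J r s p q i (x, y) → Region c J r s p q j (z, t) →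
      ¬ (z - x - u = 0 ∧ t - y - w = 0) ∧ ¬ IsStep r s (z - x - u, t - y - w)) :
    Apart (IsStep r s) (a i) (a j) (u, w) := by
  intro x hx y hy hN
  obtain ⟨h0, h1⟩ := h x.1 x.2 y.1 y.2 (H.shape.mem_region i x hx) (H.shape.mem_region j y hy)
  rcases hN with hN | hN
  · exact h0 (by simpa [Prod.ext_iff] using hN)
  · exact h1 hN

/-- Paths on opposite sides, for displacements that occur in the `f`-lift and in the `h`-lift. This
is where `east_pair` is needed. -/
theorem State.apart_west_east (H : State c J m n r s p q a)
    (hc : c ≠ 2 → Clear c J m n r s p q 4 0 (2 * p + 2 * q) 0) :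
    Apart (IsStep r s) (a 4) (a 0) (2 * p + 2 * q, 0) := by
  by_cases h2 : c = 2
  · subst h2
    intro x hx y hy hN
    have gx := H.shape.mem_region 4 x hx
    have gy := H.shape.mem_region 0 y hy
    have P := H.params
    -- the mirror image of `x` in the vertical axis
    have hx' : (-x.1, x.2) ∈ a 0 := by
      simpa using (H.shape.mem_rot (i := 0)).1 ((H.shape.mem_rot (i := 2)).1
        ((H.shape.mem_flip (i := 4)).1 hx))
    have k1 := H.shape.east_pair rfl _ hx' _ hy
    have k2 := H.shape.east_pair rfl _ hy _ hx'
    simp only [Region, EastRegion, Int.reduceEq, false_imp_iff, true_imp_iff, true_and,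
      and_true] at gx gy
    simp only [Params, Int.reduceEq, false_and, true_and, or_false, false_or] at P
    dsimp only at k1 k2
    obtain ⟨u, hu⟩ : ∃ u, u = y.1 - x.1 - (2 * p + 2 * q) := ⟨_, rfl⟩
    obtain ⟨w, hw⟩ : ∃ w, w = y.2 - x.2 := ⟨_, rfl⟩
    have hN : Near (IsStep r s) (u, w) := by
      convert hN using 1
      ext <;> simp [hu, hw]
    rcases hN with hN | hN
    · rw [Prod.mk_eq_zero] at hN
      omega
    · simp only [IsStep] at hN
      omega
  · exact H.apart_of_clear (hc h2)

/-! ### Symmetry of the lifts -/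

theorem Symmetric.reverse_flip (S : Symmetric a) {i j : Fin 8} (h : -i = j) :
    ((a i).map LeaperCycle.flip).reverse = a j := by
  rw [← S.flip, h]

theorem Symmetric.map_flip (S : Symmetric a) {i j : Fin 8} (h : -i = j) :
    (a i).map LeaperCycle.flip = (a j).reverse := by
  rw [← S.reverse_flip h, List.reverse_reverse]

theorem Symmetric.map_rot (S : Symmetric a) {i j : Fin 8} (h : i + 2 = j) :
    (a i).map LeaperCycle.rot = a j := by
  rw [← S.rot, h]

theorem map_translatePath (φ : ℤ × ℤ →+ ℤ × ℤ) (w : List (ℤ × ℤ)) (v : ℤ × ℤ) :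
    (translatePath w v).map φ = translatePath (w.map φ) (φ v) := by
  simp [translatePath, Function.comp_def]

theorem reverse_translatePath (w : List (ℤ × ℤ)) (v : ℤ × ℤ) :
    (translatePath w v).reverse = translatePath w.reverse v := by
  simp [translatePath]

theorem Symmetric.f (S : Symmetric a) (p q : ℤ) : Symmetric (LiftType.f.lift p q a) := by
  constructor <;> intro i
  · simp only [LiftType.lift, fin8_val_add_two, dirVec_add_two]
    split_ifs
    · rw [map_translatePath, map_zsmul]
      simp only [List.map_append, List.map_reverse]
      rw [S.map_rot (add_right_comm i 5 2), S.map_rot (add_right_comm i 4 2),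
        S.map_rot (add_right_comm i 3 2)]
    · rw [map_translatePath, map_zsmul, S.rot]
  · simp only [LiftType.lift, fin8_val_neg, dirVec_neg]
    split_ifs
    · rw [map_translatePath, map_zsmul, reverse_translatePath]
      simp only [List.map_append, List.map_reverse, List.reverse_append, List.reverse_reverse]
      rw [S.map_flip (i := i + 5) (j := -i + 3) (by grind),
        S.map_flip (i := i + 4) (j := -i + 4) (by grind),
        S.map_flip (i := i + 3) (j := -i + 5) (by grind)]
      simp
    · rw [map_translatePath, map_zsmul, reverse_translatePath, S.flip]

theorem Symmetric.h (S : Symmetric a) (p q : ℤ) : Symmetric (LiftType.h.lift p q a) := by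
  constructor <;> intro i
  · simp only [LiftType.lift, fin8_val_add_two, dirVec_add_two]
    split_ifs
    · rw [map_translatePath, map_zsmul]
      simp only [List.map_append, List.map_reverse]
      rw [S.map_rot (add_right_comm i 6 2), S.map_rot (add_right_comm i 5 2),
        S.map_rot (add_right_comm i 4 2), S.map_rot (add_right_comm i 3 2),
        S.map_rot (i := i + 2) rfl]
    · rw [map_translatePath, map_zsmul]
      simp only [List.map_append]
      rw [S.map_rot (i := i - 1) (j := i + 2 - 1) (by grind), S.map_rot (i := i) rfl,
        S.map_rot (add_right_comm i 1 2)]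
  · simp only [LiftType.lift, fin8_val_neg, dirVec_neg]
    split_ifs
    · rw [map_translatePath, map_zsmul, reverse_translatePath]
      simp only [List.map_append, List.map_reverse, List.reverse_append, List.reverse_reverse]
      rw [S.map_flip (i := i + 6) (j := -i + 2) (by grind),
        S.map_flip (i := i + 5) (j := -i + 3) (by grind),
        S.map_flip (i := i + 4) (j := -i + 4) (by grind),
        S.map_flip (i := i + 3) (j := -i + 5) (by grind),
        S.map_flip (i := i + 2) (j := -i + 6) (by grind)]
      simp
    · rw [map_translatePath, map_zsmul, reverse_translatePath]
      simp only [List.map_append, List.reverse_append]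
      rw [S.map_flip (i := i - 1) (j := -i + 1) (by grind), S.map_flip (i := i) rfl,
        S.map_flip (i := i + 1) (j := -i - 1) (by grind)]
      simp

theorem fin8_val_add_one (i : Fin 8) : ((i + 1 : Fin 8) : ℕ) % 2 = 0 ↔ ¬ (i : ℕ) % 2 = 0 := by
  revert i
  decide

theorem dirVec_add_one_of_even (i : Fin 8) (h : (i : ℕ) % 2 = 0) :
    dirVec (i + 1) = turn (dirVec i) := by
  revert i
  refine forall_fin8 ?_ ?_ ?_ ?_ ?_ ?_ ?_ ?_ <;> decide

theorem dirVec_add_one_of_odd (i : Fin 8) (h : ¬ (i : ℕ) % 2 = 0) :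
    (2 : ℤ) • dirVec (i + 1) = turn (dirVec i) := by
  revert i
  refine forall_fin8 ?_ ?_ ?_ ?_ ?_ ?_ ?_ ?_ <;> decide

/-- The map `turn` transforms `g`-lifts into `f`-lifts. -/
theorem twist_g (p q : ℤ) (a : OctCycle) :
    twist (LiftType.g.lift p q a) = LiftType.f.lift (q - p) (q + p) (twist a) := by
  funext i
  obtain ⟨i, rfl⟩ : ∃ j, i = j + 1 := ⟨i - 1, by simp⟩
  rw [twist_add_one]
  simp only [LiftType.lift, fin8_val_add_one, ite_not]
  rw [add_right_comm i 1 5, add_right_comm i 1 4, add_right_comm i 1 3]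
  simp only [twist_add_one]
  split_ifs with h
  · rw [map_translatePath, map_zsmul, dirVec_add_one_of_even i h]
  · rw [map_translatePath, map_zsmul, ← dirVec_add_one_of_odd i h, smul_smul]
    simp only [List.map_append, List.map_reverse]
    congr 2
    ring

/-- The map `turn` transforms `ħ`-lifts into `h`-lifts. -/
theorem twist_hbar (p q : ℤ) (a : OctCycle) :
    twist (LiftType.hbar.lift p q a) = LiftType.h.lift (q - p) (q + p) (twist a) := by
  funext i
  obtain ⟨i, rfl⟩ : ∃ j, i = j + 1 := ⟨i - 1, by simp⟩
  rw [twist_add_one]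
  simp only [LiftType.lift, fin8_val_add_one, ite_not]
  rw [add_right_comm i 1 6, add_right_comm i 1 5, add_right_comm i 1 4, add_right_comm i 1 3,
    add_right_comm i 1 2, show i + 1 - 1 = i - 1 + 1 by grind]
  simp only [twist_add_one]
  split_ifs with h
  · rw [map_translatePath, map_zsmul, dirVec_add_one_of_even i h]
    simp only [List.map_append]
    congr 2
    ring
  · rw [map_translatePath, map_zsmul, ← dirVec_add_one_of_odd i h, smul_smul]
    simp only [List.map_append, List.map_reverse]
    congr 2
    ring

/-! ### The `f`-lift -/

/-- The pairs of paths that arise from the pairs (E, N), (E, NW), (E, W), (NE, NW), (NE, SW) of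
paths of an `f`-lift and that are excluded by position. -/
theorem clear_f (P : Params c J m n r s p q) :
    (Clear c J m n r s p q 5 7 (p + q) (-p - q) ∧ Clear c J m n r s p q 5 6 (p + q) (-p - q) ∧
    Clear c J m n r s p q 5 5 (p + q) (-p - q) ∧ Clear c J m n r s p q 4 5 (p + q) (-p - q) ∧
    Clear c J m n r s p q 3 5 (p + q) (-p - q)) ∧
    (Clear c J m n r s p q 5 3 (2 * p + q) (-p) ∧
    (c ≠ 2 → Clear c J m n r s p q 4 3 (2 * p + q) (-p)) ∧
    Clear c J m n r s p q 3 3 (2 * p + q) (-p)) ∧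
    (Clear c J m n r s p q 5 0 (2 * p + 2 * q) 0 ∧ Clear c J m n r s p q 5 1 (2 * p + 2 * q) 0 ∧
    Clear c J m n r s p q 5 7 (2 * p + 2 * q) 0 ∧
    (c ≠ 2 → Clear c J m n r s p q 4 0 (2 * p + 2 * q) 0) ∧
    Clear c J m n r s p q 4 1 (2 * p + 2 * q) 0 ∧
    Clear c J m n r s p q 4 7 (2 * p + 2 * q) 0 ∧
    Clear c J m n r s p q 3 0 (2 * p + 2 * q) 0 ∧ Clear c J m n r s p q 3 1 (2 * p + 2 * q) 0 ∧
    Clear c J m n r s p q 3 7 (2 * p + 2 * q) 0) ∧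
    (c ≠ 2 → Clear c J m n r s p q 1 3 (2 * p) 0) ∧
    (c ≠ 2 → Clear c J m n r s p q 1 5 (2 * p) (2 * p)) := by
  obtain ⟨h1, h2, h3, h4, h5, h6, h7, h8, h9, h10, ⟨rfl, P⟩ | ⟨rfl, P⟩ | ⟨rfl, P⟩⟩ := P <;>
  refine ⟨⟨?_, ?_, ?_, ?_, ?_⟩, ⟨?_, ?_, ?_⟩, ⟨?_, ?_, ?_, ?_, ?_, ?_, ?_, ?_, ?_⟩, ?_, ?_⟩ <;>
  simp only [Clear, Region, EastRegion, NortheastRegion, Small, Int.reduceEq,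
    not_true, ne_eq, false_imp_iff, true_imp_iff, true_and, and_true] <;>
  omega

/-- The analogue of `clear_f` for paths of an `f`-lift displaced by a move of the new leaper. -/
theorem clear_move_f (P : Params c J m n r s p q) (hc : c ≠ 2) :
    (Clear c J m n r s p q 5 5 p (2 * p + q) ∧ Clear c J m n r s p q 4 5 p (2 * p + q) ∧
    Clear c J m n r s p q 3 5 p (2 * p + q) ∧ Clear c J m n r s p q 3 4 p (2 * p + q) ∧
    Clear c J m n r s p q 3 3 p (2 * p + q) ∧ Clear c J m n r s p q 1 3 (p - q) (p + q) ∧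
    Clear c J m n r s p q 1 4 (p - q) (p + q) ∧ Clear c J m n r s p q 5 4 p (2 * p + q) ∧
    Clear c J m n r s p q 4 4 p (2 * p + q)) ∧
    Clear c J m n r s p q 3 1 (q - p) (p + q) ∧ Clear c J m n r s p q 1 1 (-p) (2 * p + q) := by
  obtain ⟨h1, h2, h3, h4, h5, h6, h7, h8, h9, h10, ⟨rfl, P⟩ | ⟨rfl, P⟩ | ⟨rfl, P⟩⟩ := P
  rotate_left 1
  · exact absurd rfl hc
  all_goals
  refine ⟨⟨?_, ?_, ?_, ?_, ?_, ?_, ?_, ?_, ?_⟩, ?_, ?_⟩ <;>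
  simp only [Clear, Region, EastRegion, NortheastRegion, Small, Int.reduceEq,
    false_imp_iff, true_imp_iff, true_and, and_true] <;>
  omega

/-- The pairs that `clear_f` leaves open in the regime `c = 2`, apart from the one that
`State.apart_west_east` deals with. -/
theorem State.apart_f (H : State 2 J m n r s p q a) :
    Apart (IsStep r s) (a 4) (a 3) (2 * p + q, -p) ∧ Apart (IsStep r s) (a 1) (a 3) (2 * p, 0) ∧
      Apart (IsStep r s) (a 1) (a 5) (2 * p, 2 * p) := by
  have P := H.params
  simp only [Params, Int.reduceEq, false_and, true_and, or_false, false_or] at P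
  refine ⟨H.apart_of_exact ?_, H.apart_of_exact ?_, H.apart_of_exact ?_⟩ <;>
  · intro x y z t gx gy
    simp only [Region, EastRegion, NortheastRegion, Int.reduceEq, false_imp_iff, true_imp_iff,
      true_and, and_true] at gx gy
    simp only [IsStep]
    omega

theorem Shape.f (P : Params c J m n r s p q) (S : Shape c J r s p q a) :
    Shape (if c = 2 then 2 else 1) (J + s) r s p (2 * p + q) (LiftType.f.lift p q a) := by
  have e0 : LiftType.f.lift p q a 0 =
      ((a 5).reverse ++ (a 4).reverse ++ (a 3).reverse).map (· + (p + q, 0)) := by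
    simp [LiftType.lift, translatePath, dirVec]
  have e1 : LiftType.f.lift p q a 1 = (a 1).map (· + (p, p)) := by
    simp [LiftType.lift, translatePath, dirVec]
  have S3 := S.mem_region 3
  have S4 := S.mem_region 4
  have S5 := S.mem_region 5
  have S1 := S.mem_region 1
  have pair : c = 2 → ∀ x ∈ a 4, ∀ y ∈ a 4, y.2 - x.2 = s →
      x.1 + y.1 = -(r + 2 * s + 2 * J) := by
    intro hc x hx y hy h
    have := S.east_pair hc _ ((S.mem_rot (i := 0)).1 ((S.mem_rot (i := 2)).1 hy)) _
      ((S.mem_rot (i := 0)).1 ((S.mem_rot (i := 2)).1 hx)) (by dsimp only; omega)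
    dsimp only at this
    omega
  have P' := P
  refine ⟨S.toSymmetric.f p q, ?_, ?_, ?_, ?_⟩
  · rw [e0]
    simp only [List.forall_mem_map, List.forall_mem_append, List.mem_reverse]
    obtain ⟨h1, h2, h3, h4, h5, h6, h7, h8, h9, h10, ⟨rfl, P⟩ | ⟨rfl, P⟩ | ⟨rfl, P⟩⟩ := P' <;>
    (refine ⟨⟨?_, ?_⟩, ?_⟩
     on_goal 1 => intro x hx; have gx := S5 x hx
     on_goal 2 => intro x hx; have gx := S4 x hx
     on_goal 3 => intro x hx; have gx := S3 x hx) <;>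
    simp only [Region, EastRegion, NortheastRegion, Int.reduceEq, if_true, if_false, Prod.fst_add,
      Prod.snd_add, false_imp_iff, true_imp_iff, true_and, and_true] at gx ⊢ <;>
    omega
  · rw [e1]
    simp only [List.forall_mem_map]
    intro x hx
    have gx := S1 x hx
    obtain ⟨h1, h2, h3, h4, h5, h6, h7, h8, h9, h10, ⟨rfl, P⟩ | ⟨rfl, P⟩ | ⟨rfl, P⟩⟩ := P' <;>
    simp only [Region, NortheastRegion, Int.reduceEq, if_true, if_false, Prod.fst_add,
      Prod.snd_add, false_imp_iff, true_imp_iff, true_and, and_true] at gx ⊢ <;>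
    omega
  · intro hc
    have hc : c = 2 := by
      by_contra h
      simp [h] at hc
    subst hc
    have key := pair rfl
    rw [e0]
    simp only [Region, EastRegion, NortheastRegion, Int.reduceEq,
      false_imp_iff, true_imp_iff, true_and, and_true] at S3 S4 S5
    simp only [Params, Int.reduceEq, false_and, true_and, or_false, false_or] at P
    simp only [List.mem_map, List.mem_append, List.mem_reverse]
    rintro _ ⟨x, (hx | hx) | hx, rfl⟩ _ ⟨y, (hy | hy) | hy, rfl⟩ h <;>
    simp only [Prod.fst_add, Prod.snd_add] at h ⊢
    · have := S5 x hx
      have := S5 y hy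
      omega
    · have := S5 x hx
      have := S4 y hy
      omega
    · have := S5 x hx
      have := S3 y hy
      omega
    · have := S4 x hx
      have := S5 y hy
      omega
    · have := key x hx y hy (by omega)
      omega
    · have := S4 x hx
      have := S3 y hy
      omega
    · have := S3 x hx
      have := S5 y hy
      omega
    · have := S3 x hx
      have := S4 y hy
      omega
    · have := S3 x hx
      have := S3 y hy
      omega
  · split_ifs <;> intro h <;> omega

theorem getLast_append_reverse {α : Type*} {l l' : List α} (h : l ≠ []) :
    (l' ++ l.reverse).getLast? = l.head? := by
  rw [List.getLast?_append_of_ne_nil _ (by simpa using h), List.getLast?_reverse]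

theorem State.f (H : State c J m n r s p q a) :
    State (if c = 2 then 2 else 1) (J + s) m n r s p (2 * p + q) (LiftType.f.lift p q a) := by
  obtain ⟨P, S, O⟩ := id H
  have hs : IsStepSet (IsStep r s) := isStepSet P.1
  have S' := S.f P
  have P' : Params (if c = 2 then 2 else 1) (J + s) m n r s p (2 * p + q) := by
    unfold Params at P ⊢
    split_ifs <;> omega
  refine ⟨P', S', ?_⟩
  have e0 : LiftType.f.lift p q a 0 =
      ((a 5).reverse ++ (a 4).reverse ++ (a 3).reverse).map (· + (p + q, 0)) := by
    simp [LiftType.lift, translatePath, dirVec]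
  have e1 : LiftType.f.lift p q a 1 = (a 1).map (· + (p, p)) := by
    simp [LiftType.lift, translatePath, dirVec]
  have e2 : LiftType.f.lift p q a 2 =
      ((a 7).reverse ++ (a 6).reverse ++ (a 5).reverse).map (· + (0, p + q)) := by
    simp [LiftType.lift, translatePath, dirVec]
  have e3 : LiftType.f.lift p q a 3 = (a 3).map (· + (-p, p)) := by
    simp [LiftType.lift, translatePath, dirVec]
  have e4 : LiftType.f.lift p q a 4 =
      ((a 1).reverse ++ (a 0).reverse ++ (a 7).reverse).map (· + (-p - q, 0)) := by
    simp [LiftType.lift, translatePath, dirVec, add_comm, sub_eq_add_neg]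
  have e5 : LiftType.f.lift p q a 5 = (a 5).map (· + (-p, -p)) := by
    simp [LiftType.lift, translatePath, dirVec]
  have e7 : LiftType.f.lift p q a 7 = (a 7).map (· + (p, -p)) := by
    simp [LiftType.lift, translatePath, dirVec]
  obtain ⟨⟨c57, c56, c55, c45, c35⟩, ⟨c53, c43, c33⟩,
    ⟨d50, d51, d57, d40, d41, d47, d30, d31, d37⟩, c13, c15⟩ := clear_f P
  have link' : Linked (IsStep r s) (LiftType.f.lift p q a 0) (LiftType.f.lift p q a 1) := by
    rw [e0, e1]
    constructor
    · simp only [List.mem_map, List.mem_append, List.mem_reverse]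
      rintro _ ⟨x, hx, rfl⟩ _ ⟨y, hy, rfl⟩ hN
      have hv : y + (p, p) - (x + (p + q, 0)) = y - x - move p q 7 := by
        ext <;> simp [move] <;> ring
      rw [hv] at hN
      -- the move carries the last square of the path E of the lift, a copy of the first one of
      -- `a 3`, to the last one of `a 0`, so that the junction is a copy of that of `a 0` and `a 1`
      have hx' : x ∈ a 3 ∨ x ∈ a 4 := by
        rcases hx with (hx | hx) | hx
        · exact absurd hN (O.apart_move' (by decide) x hx y hy)
        · exact Or.inr hx
        · exact Or.inl hx
      have hw : y - x - move p q 7 = y - (x + move p q 7) - 0 := by abel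
      rcases O.add_mem 7 hx' with h | h
      · exact absurd hN ((O.apart' (by decide)).sub h hy hw)
      · rw [hw, sub_zero] at hN
        obtain ⟨h1, h2⟩ := (O.link 0).ends _ h y hy hN
        have h3 : (a 3).head? = some x := (O.head_iff 7 x).2 h1
        have h2 : (a 1).head? = some y := h2
        rw [List.getLast?_map, getLast_append_reverse (O.ne_nil 3), List.head?_map, h3, h2]
        exact ⟨rfl, rfl⟩
    · rw [List.getLast?_map, getLast_append_reverse (O.ne_nil 3), List.head?_map]
      simp only [Option.mem_def, Option.map_eq_some_iff]
      rintro _ ⟨x, hx, rfl⟩ _ ⟨y, hy, rfl⟩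
      have := (O.link 0).step _ ((O.head_iff 7 x).1 hx) y hy
      convert this using 1
      ext <;> simp [move] <;> ring
  refine Octagon.of_representatives P' S' ?_ ?_ ?_ ?_ link' ?_ ?_ ?_ ?_ ?_ ?_ ?_ ?_ ?_
  · simp [e0, O.ne_nil]
  · simp [e1, O.ne_nil]
  · rw [e0, show (a 5).reverse ++ (a 4).reverse ++ (a 3).reverse = (a 3 ++ a 4 ++ a 5).reverse by
      simp]
    exact (((((O.path 3).append hs (O.path 4) (O.link 3)).append hs (O.path 5)
      ((O.link 4).append_left (O.apart' (by decide)) (O.ne_nil 4))).reverse hs).translate _)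
  · rw [e1]
    exact (O.path 1).translate _
  · rw [e0, e2, apart_map_add,
      show (0 + (p + q, 0) - (0, p + q) : ℤ × ℤ) = (p + q, -p - q) by ext <;> simp; ring]
    simp only [apart_append_left, apart_reverse_left]
    simp only [apart_append_right, apart_reverse_right]
    have v7 : (p + q, -p - q) - move p q 7 = (p, -q) := by ext <;> simp [move]; ring
    have v2 : (p, -q) + move p q 2 = 0 := by ext <;> simp [move]
    have v6 : (p + q, -p - q) - move p q 6 = (q, -p) := by ext <;> simp [move]
    have v3 : (q, -p) + move p q 3 = 0 := by ext <;> simp [move]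
    refine ⟨⟨⟨⟨H.apart_of_clear c57, H.apart_of_clear c56⟩, H.apart_of_clear c55⟩,
      ⟨⟨?_, ?_⟩, H.apart_of_clear c45⟩⟩, ⟨⟨?_, ?_⟩, H.apart_of_clear c35⟩⟩
    · exact O.exchange_left 7 (by decide) v7
        (O.exchange_right 2 (by decide) v2 (O.apart' (by decide)) (O.apart' (by decide)))
        (O.exchange_right 2 (by decide) v2 (O.apart' (by decide)) (O.apart' (by decide)))
    · exact O.exchange_left 7 (by decide) v7
        (O.exchange_right 2 (by decide) v2 (O.apart' (by decide)) (O.apart' (by decide)))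
        (O.exchange_right 2 (by decide) v2 (O.apart' (by decide)) (O.apart' (by decide)))
    · exact O.exchange_left 6 (by decide) v6
        (O.exchange_right 3 (by decide) v3 (O.apart' (by decide)) (O.apart' (by decide)))
        (O.exchange_right 3 (by decide) v3 (O.apart' (by decide)) (O.apart' (by decide)))
    · exact O.exchange_left 6 (by decide) v6 (O.apart_move' (k := 7) (by decide))
        (O.apart_move' (k := 7) (by decide))
  · rw [e0, e3, apart_map_add,
      show (0 + (p + q, 0) - (-p, p) : ℤ × ℤ) = (2 * p + q, -p) by ext <;> simp; ring]
    simp only [apart_append_left, apart_reverse_left]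
    refine ⟨⟨H.apart_of_clear c53, ?_⟩, H.apart_of_clear c33⟩
    by_cases hc : c = 2
    · subst hc
      exact H.apart_f.1
    · exact H.apart_of_clear (c43 hc)
  · rw [e0, e4, apart_map_add,
      show (0 + (p + q, 0) - (-p - q, 0) : ℤ × ℤ) = (2 * p + 2 * q, 0) by ext <;> simp; ring]
    simp only [apart_append_left, apart_reverse_left]
    simp only [apart_append_right, apart_reverse_right]
    exact ⟨⟨⟨⟨H.apart_of_clear d51, H.apart_of_clear d50⟩, H.apart_of_clear d57⟩,
      ⟨⟨H.apart_of_clear d41, H.apart_west_east d40⟩, H.apart_of_clear d47⟩⟩,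
      ⟨⟨H.apart_of_clear d31, H.apart_of_clear d30⟩, H.apart_of_clear d37⟩⟩
  · rw [e1, e3, apart_map_add,
      show (0 + (p, p) - (-p, p) : ℤ × ℤ) = (2 * p, 0) by ext <;> simp; ring]
    by_cases hc : c = 2
    · subst hc
      exact H.apart_f.2.1
    · exact H.apart_of_clear (c13 hc)
  · rw [e1, e5, apart_map_add,
      show (0 + (p, p) - (-p, -p) : ℤ × ℤ) = (2 * p, 2 * p) by ext <;> simp <;> ring]
    by_cases hc : c = 2
    · subst hc
      exact H.apart_f.2.2
    · exact H.apart_of_clear (c15 hc)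
  · have k4 : (a 5).reverse ++ (a 4).reverse =
        (a 0).map (· + move p q 4) ++ (a 1).map (· + move p q 4) := by
      rw [← List.reverse_append, ← List.map_append]
      exact (O.exchange 4).symm
    rw [e7, e0, e3, e4, k4]
    simp [Function.comp_def, add_assoc, move]
    ring_nf
    simp only [add_comm]
  · intro hc
    have hc : c ≠ 2 := by
      rintro rfl
      simp at hc
    obtain ⟨⟨c55, c45, c35, c34, c33, c13, c14, c54, c44⟩, -, -⟩ := clear_move_f P hc
    rw [e0, apart_map_add, add_sub_cancel_right]
    have v0 : move p (2 * p + q) 1 - move p q 0 = (p - q, p + q) := by ext <;> simp [move]; ring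
    have v3 : (p - q, p + q) - move p q 3 = move p q 1 := by ext <;> simp [move]
    have key : ∀ i : Fin 8, i = 0 + 4 ∨ i = 0 + 5 →
        Apart (IsStep r s) (a i) (a 3) (move p (2 * p + q) 1) := fun i hi =>
      O.exchange_left 0 hi v0 (O.exchange_left 3 (by decide) v3 (O.apart_move' (by decide))
        (O.apart_move' (by decide))) (H.apart_of_clear c13)
    simp only [apart_append_left, apart_reverse_left]
    simp only [apart_append_right, apart_reverse_right]
    exact ⟨⟨⟨⟨H.apart_of_clear c55, H.apart_of_clear c54⟩, key 5 (by decide)⟩,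
      ⟨⟨H.apart_of_clear c45, H.apart_of_clear c44⟩, key 4 (by decide)⟩⟩,
      ⟨⟨H.apart_of_clear c35, H.apart_of_clear c34⟩, H.apart_of_clear c33⟩⟩
  · intro hc
    have hc : c ≠ 2 := by
      rintro rfl
      simp at hc
    obtain ⟨-, c31, -⟩ := clear_move_f P hc
    rw [e0, e1, apart_map_add, show move p (2 * p + q) 2 + (p + q, 0) - (p, p) = (q - p, p + q) by
      ext <;> simp [move]; ring]
    have v0 : (q - p, p + q) - move p q 0 = move p q 2 := by ext <;> simp [move]
    simp only [apart_append_left, apart_reverse_left]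
    exact ⟨⟨O.exchange_left 0 (by decide) v0 (O.apart_move' (by decide))
      (O.apart_move' (by decide)),
      O.exchange_left 0 (by decide) v0 (O.apart_move' (by decide)) (O.apart_move' (by decide))⟩,
      H.apart_of_clear c31⟩
  · intro hc
    have hc : c ≠ 2 := by
      rintro rfl
      simp at hc
    obtain ⟨-, -, c11⟩ := clear_move_f P hc
    rw [e1, apart_map_add, add_sub_cancel_right]
    exact H.apart_of_clear c11

/-! ### The `h`-lift -/

set_option maxHeartbeats 1000000 in
/-- Pairs of paths of `a` that arise from a pair of paths of the `h`-lift and are excluded by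
position. The digits in the name, here and below, are the numbers of the two paths of the lift;
`move` in a name stands for a displacement by a move of the new leaper. -/
theorem clear_h_02a (P : Params c J m n r s p q) :
    ∀ i ∈ ([6, 5] : List (Fin 8)), ∀ j ∈ ([0, 7, 6, 5, 4] : List (Fin 8)),
      Clear c J m n r s p q i j (p + q) (-p - q) := by
  intro i hi j hj
  obtain ⟨h1, h2, h3, h4, h5, h6, h7, h8, h9, h10, ⟨rfl, P⟩ | ⟨rfl, P⟩ | ⟨rfl, P⟩⟩ := P <;>
  simp only [List.mem_cons, List.not_mem_nil, or_false] at hi hj <;>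
  rcases hi with rfl | rfl <;>
  rcases hj with rfl | rfl | rfl | rfl | rfl <;>
  simp only [Clear, Region, EastRegion, NortheastRegion, Small, Int.reduceEq,
    false_imp_iff, true_imp_iff, true_and, and_true] <;>
  omega

set_option maxHeartbeats 1000000 in
theorem clear_h_02b (P : Params c J m n r s p q) :
    ∀ i ∈ ([4, 3, 2] : List (Fin 8)), ∀ j ∈ ([5, 4] : List (Fin 8)),
      Clear c J m n r s p q i j (p + q) (-p - q) := by
  intro i hi j hj
  obtain ⟨h1, h2, h3, h4, h5, h6, h7, h8, h9, h10, ⟨rfl, P⟩ | ⟨rfl, P⟩ | ⟨rfl, P⟩⟩ := P <;>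
  simp only [List.mem_cons, List.not_mem_nil, or_false] at hi hj <;>
  rcases hi with rfl | rfl | rfl <;>
  rcases hj with rfl | rfl <;>
  simp only [Clear, Region, EastRegion, NortheastRegion, Small, Int.reduceEq,
    false_imp_iff, true_imp_iff, true_and, and_true] <;>
  omega

set_option maxHeartbeats 1000000 in
theorem clear_h_03 (P : Params c J m n r s p q) :
    ∀ i ∈ ([6, 5, 4, 3, 2] : List (Fin 8)), ∀ j ∈ ([2, 3, 4] : List (Fin 8)),
      Clear c J m n r s p q i j (p + 2 * q) (-q) := by
  intro i hi j hj
  obtain ⟨h1, h2, h3, h4, h5, h6, h7, h8, h9, h10, ⟨rfl, P⟩ | ⟨rfl, P⟩ | ⟨rfl, P⟩⟩ := P <;>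
  simp only [List.mem_cons, List.not_mem_nil, or_false] at hi hj <;>
  rcases hi with rfl | rfl | rfl | rfl | rfl <;>
  rcases hj with rfl | rfl | rfl <;>
  simp only [Clear, Region, EastRegion, NortheastRegion, Small, Int.reduceEq,
    false_imp_iff, true_imp_iff, true_and, and_true] <;>
  omega

set_option maxHeartbeats 1000000 in
theorem clear_h_04 (P : Params c J m n r s p q) :
    ∀ i ∈ ([6, 5, 4, 3, 2] : List (Fin 8)), ∀ j ∈ ([2, 1, 0, 7, 6] : List (Fin 8)),
      ¬ (c = 2 ∧ i = 4 ∧ j = 0) → Clear c J m n r s p q i j (2 * p + 2 * q) 0 := by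
  intro i hi j hj
  obtain ⟨h1, h2, h3, h4, h5, h6, h7, h8, h9, h10, ⟨rfl, P⟩ | ⟨rfl, P⟩ | ⟨rfl, P⟩⟩ := P <;>
  simp only [List.mem_cons, List.not_mem_nil, or_false] at hi hj <;>
  rcases hi with rfl | rfl | rfl | rfl | rfl <;>
  rcases hj with rfl | rfl | rfl | rfl | rfl <;>
  simp only [Clear, Region, EastRegion, NortheastRegion, Small, Int.reduceEq,
    Fin.reduceEq, and_false, not_false_eq_true, and_self, not_true, false_imp_iff, true_imp_iff, true_and, and_true] <;>
  omega

set_option maxHeartbeats 1000000 in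
theorem clear_h_13 (P : Params c J m n r s p q) :
    ∀ i ∈ ([0, 1, 2] : List (Fin 8)), ∀ j ∈ ([2, 3, 4] : List (Fin 8)),
      Clear c J m n r s p q i j (2 * q) 0 := by
  intro i hi j hj
  obtain ⟨h1, h2, h3, h4, h5, h6, h7, h8, h9, h10, ⟨rfl, P⟩ | ⟨rfl, P⟩ | ⟨rfl, P⟩⟩ := P <;>
  simp only [List.mem_cons, List.not_mem_nil, or_false] at hi hj <;>
  rcases hi with rfl | rfl | rfl <;>
  rcases hj with rfl | rfl | rfl <;>
  simp only [Clear, Region, EastRegion, NortheastRegion, Small, Int.reduceEq,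
    false_imp_iff, true_imp_iff, true_and, and_true] <;>
  omega

set_option maxHeartbeats 1000000 in
theorem clear_h_15 (P : Params c J m n r s p q) :
    ∀ i ∈ ([0, 1, 2] : List (Fin 8)), ∀ j ∈ ([4, 5, 6] : List (Fin 8)),
      Clear c J m n r s p q i j (2 * q) (2 * q) := by
  intro i hi j hj
  obtain ⟨h1, h2, h3, h4, h5, h6, h7, h8, h9, h10, ⟨rfl, P⟩ | ⟨rfl, P⟩ | ⟨rfl, P⟩⟩ := P <;>
  simp only [List.mem_cons, List.not_mem_nil, or_false] at hi hj <;>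
  rcases hi with rfl | rfl | rfl <;>
  rcases hj with rfl | rfl | rfl <;>
  simp only [Clear, Region, EastRegion, NortheastRegion, Small, Int.reduceEq,
    false_imp_iff, true_imp_iff, true_and, and_true] <;>
  omega

set_option maxHeartbeats 1000000 in
theorem clear_move_h_00 (P : Params c J m n r s p q) :
    ∀ i ∈ ([6, 5, 4, 3, 2] : List (Fin 8)), ∀ j ∈ ([6, 5, 4, 3, 2] : List (Fin 8)),
      Clear c J m n r s p q i j q (p + 2 * q) := by
  intro i hi j hj
  obtain ⟨h1, h2, h3, h4, h5, h6, h7, h8, h9, h10, ⟨rfl, P⟩ | ⟨rfl, P⟩ | ⟨rfl, P⟩⟩ := P <;>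
  simp only [List.mem_cons, List.not_mem_nil, or_false] at hi hj <;>
  rcases hi with rfl | rfl | rfl | rfl | rfl <;>
  rcases hj with rfl | rfl | rfl | rfl | rfl <;>
  simp only [Clear, Region, EastRegion, NortheastRegion, Small, Int.reduceEq,
    false_imp_iff, true_imp_iff, true_and, and_true] <;>
  omega

set_option maxHeartbeats 1000000 in
theorem clear_move_h_11 (P : Params c J m n r s p q) :
    ∀ i ∈ ([0, 1, 2] : List (Fin 8)), ∀ j ∈ ([0, 1, 2] : List (Fin 8)),
      Clear c J m n r s p q i j (-q) (p + 2 * q) := by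
  intro i hi j hj
  obtain ⟨h1, h2, h3, h4, h5, h6, h7, h8, h9, h10, ⟨rfl, P⟩ | ⟨rfl, P⟩ | ⟨rfl, P⟩⟩ := P <;>
  simp only [List.mem_cons, List.not_mem_nil, or_false] at hi hj <;>
  rcases hi with rfl | rfl | rfl <;>
  rcases hj with rfl | rfl | rfl <;>
  simp only [Clear, Region, EastRegion, NortheastRegion, Small, Int.reduceEq,
    false_imp_iff, true_imp_iff, true_and, and_true] <;>
  omega

set_option maxHeartbeats 1000000 in
theorem clear_move_h_01 (P : Params c J m n r s p q) :
    ∀ i ∈ ([4, 3, 2] : List (Fin 8)), ∀ j ∈ ([0, 1, 2] : List (Fin 8)),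
      Clear c J m n r s p q i j (p - q) (p + q) := by
  intro i hi j hj
  obtain ⟨h1, h2, h3, h4, h5, h6, h7, h8, h9, h10, ⟨rfl, P⟩ | ⟨rfl, P⟩ | ⟨rfl, P⟩⟩ := P <;>
  simp only [List.mem_cons, List.not_mem_nil, or_false] at hi hj <;>
  rcases hi with rfl | rfl | rfl <;>
  rcases hj with rfl | rfl | rfl <;>
  simp only [Clear, Region, EastRegion, NortheastRegion, Small, Int.reduceEq,
    false_imp_iff, true_imp_iff, true_and, and_true] <;>
  omega

theorem Shape.h (P : Params c J m n r s p q) (S : Shape c J r s p q a) :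
    Shape 1 J r s q (p + 2 * q) (LiftType.h.lift p q a) := by
  have e0 : LiftType.h.lift p q a 0 = ((a 6).reverse ++ (a 5).reverse ++ (a 4).reverse ++
      (a 3).reverse ++ (a 2).reverse).map (· + (p + q, 0)) := by
    simp [LiftType.lift, translatePath, dirVec]
  have e1 : LiftType.h.lift p q a 1 = (a 0 ++ a 1 ++ a 2).map (· + (q, q)) := by
    simp [LiftType.lift, translatePath, dirVec]
  refine ⟨S.toSymmetric.h p q, ?_, ?_, fun h => absurd h (by decide),
    fun h => absurd h (by decide)⟩
  · rw [e0]
    simp only [List.forall_mem_map, List.forall_mem_append, List.mem_reverse]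
    have key : ∀ i ∈ ([6, 5, 4, 3, 2] : List (Fin 8)), ∀ x ∈ a i,
        EastRegion 1 J r s q (p + 2 * q) (x + (p + q, 0)).1 (x + (p + q, 0)).2 := by
      intro i hi x hx
      have gx := S.mem_region i x hx
      obtain ⟨h1, h2, h3, h4, h5, h6, h7, h8, h9, h10, ⟨rfl, P⟩ | ⟨rfl, P⟩ | ⟨rfl, P⟩⟩ := P <;>
      simp only [List.mem_cons, List.not_mem_nil, or_false] at hi <;>
      rcases hi with rfl | rfl | rfl | rfl | rfl <;>
      simp only [Region, EastRegion, NortheastRegion, Int.reduceEq, Prod.fst_add, Prod.snd_add,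
        false_imp_iff, true_imp_iff, true_and, and_true] at gx ⊢ <;>
      omega
    exact ⟨⟨⟨⟨key 6 (by decide), key 5 (by decide)⟩, key 4 (by decide)⟩, key 3 (by decide)⟩,
      key 2 (by decide)⟩
  · rw [e1]
    simp only [List.forall_mem_map, List.forall_mem_append]
    have key : ∀ i ∈ ([0, 1, 2] : List (Fin 8)), ∀ x ∈ a i,
        NortheastRegion 1 J r s q (p + 2 * q) (x + (q, q)).1 (x + (q, q)).2 := by
      intro i hi x hx
      have gx := S.mem_region i x hx
      obtain ⟨h1, h2, h3, h4, h5, h6, h7, h8, h9, h10, ⟨rfl, P⟩ | ⟨rfl, P⟩ | ⟨rfl, P⟩⟩ := P <;>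
      simp only [List.mem_cons, List.not_mem_nil, or_false] at hi <;>
      rcases hi with rfl | rfl | rfl <;>
      simp only [Region, EastRegion, NortheastRegion, Int.reduceEq, Prod.fst_add, Prod.snd_add,
        false_imp_iff, true_imp_iff, true_and, and_true] at gx ⊢ <;>
      omega
    exact ⟨⟨key 0 (by decide), key 1 (by decide)⟩, key 2 (by decide)⟩

theorem State.h (H : State c J m n r s p q a) :
    State 1 J m n r s q (p + 2 * q) (LiftType.h.lift p q a) := by
  obtain ⟨P, S, O⟩ := id H
  have hs : IsStepSet (IsStep r s) := isStepSet P.1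
  have S' := S.h P
  have P' : Params 1 J m n r s q (p + 2 * q) := by
    obtain ⟨h1, h2, h3, h4, h5, h6, h7, h8, h9, h10, ⟨rfl, P⟩ | ⟨rfl, P⟩ | ⟨rfl, P⟩⟩ := P <;>
    unfold Params <;>
    omega
  refine ⟨P', S', ?_⟩
  have e0 : LiftType.h.lift p q a 0 = ((a 6).reverse ++ (a 5).reverse ++ (a 4).reverse ++
      (a 3).reverse ++ (a 2).reverse).map (· + (p + q, 0)) := by
    simp [LiftType.lift, translatePath, dirVec]
  have e1 : LiftType.h.lift p q a 1 = (a 0 ++ a 1 ++ a 2).map (· + (q, q)) := by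
    simp [LiftType.lift, translatePath, dirVec]
  have e2 : LiftType.h.lift p q a 2 = ((a 0).reverse ++ (a 7).reverse ++ (a 6).reverse ++
      (a 5).reverse ++ (a 4).reverse).map (· + (0, p + q)) := by
    simp [LiftType.lift, translatePath, dirVec]
  have e3 : LiftType.h.lift p q a 3 = (a 2 ++ a 3 ++ a 4).map (· + (-q, q)) := by
    simp [LiftType.lift, translatePath, dirVec]
  have e4 : LiftType.h.lift p q a 4 = ((a 2).reverse ++ (a 1).reverse ++ (a 0).reverse ++
      (a 7).reverse ++ (a 6).reverse).map (· + (-p - q, 0)) := by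
    simp [LiftType.lift, translatePath, dirVec, add_comm, sub_eq_add_neg]
  have e5 : LiftType.h.lift p q a 5 = (a 4 ++ a 5 ++ a 6).map (· + (-q, -q)) := by
    simp [LiftType.lift, translatePath, dirVec]
  have e7 : LiftType.h.lift p q a 7 = (a 6 ++ a 7 ++ a 0).map (· + (q, -q)) := by
    simp [LiftType.lift, translatePath, dirVec]
  have link' : Linked (IsStep r s) (LiftType.h.lift p q a 0) (LiftType.h.lift p q a 1) := by
    have hd : (a 0 ++ a 1 ++ a 2).head? = (a 0).head? := by
      rw [List.append_assoc, List.head?_append_of_ne_nil _ (O.ne_nil 0)]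
    rw [e0, e1]
    constructor
    · simp only [List.mem_map, List.mem_append, List.mem_reverse]
      rintro _ ⟨x, hx, rfl⟩ _ ⟨y, hy, rfl⟩ hN
      have hv : y + (q, q) - (x + (p + q, 0)) = y - x - move p q 6 := by
        ext <;> simp [move] <;> ring
      rw [hv] at hN
      -- the move carries the last square of the path E of the lift, a copy of the first one of
      -- `a 2`, to the last one of `a 7`, so that the junction is a copy of that of `a 7` and `a 0`
      have hx' : x ∈ a 2 ∨ x ∈ a 3 := by
        have key : ∀ i ∈ ([6, 5, 4] : List (Fin 8)), x ∉ a i := by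
          intro i hi hx
          simp only [List.mem_cons, List.not_mem_nil, or_false] at hi
          rcases hy with (hy | hy) | hy <;> rcases hi with rfl | rfl | rfl <;>
          exact O.apart_move' (by decide) x hx y hy hN
        rcases hx with (((hx | hx) | hx) | hx) | hx
        · exact absurd hx (key 6 (by decide))
        · exact absurd hx (key 5 (by decide))
        · exact absurd hx (key 4 (by decide))
        · exact Or.inr hx
        · exact Or.inl hx
      have hw : y - x - move p q 6 = y - (x + move p q 6) - 0 := by abel
      rcases O.add_mem 6 hx' with h | h
      · rcases hy with (hy | hy) | hy <;>
        exact absurd hN ((O.apart' (by decide)).sub h hy hw)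
      · rcases hy with (hy | hy) | hy
        · rw [hw, sub_zero] at hN
          obtain ⟨h1, h2⟩ := (O.link 7).ends _ h y hy hN
          have h3 : (a 2).head? = some x := (O.head_iff 6 x).2 h1
          have h2 : (a 0).head? = some y := h2
          rw [List.getLast?_map, getLast_append_reverse (O.ne_nil 2), List.head?_map, hd, h3, h2]
          exact ⟨rfl, rfl⟩
        · exact absurd hN ((O.apart' (by decide)).sub h hy hw)
        · exact absurd hN ((O.apart' (by decide)).sub h hy hw)
    · rw [List.getLast?_map, getLast_append_reverse (O.ne_nil 2), List.head?_map, hd]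
      simp only [Option.mem_def, Option.map_eq_some_iff]
      rintro _ ⟨x, hx, rfl⟩ _ ⟨y, hy, rfl⟩
      have := (O.link 7).step _ ((O.head_iff 6 x).1 hx) y hy
      convert this using 1
      ext <;> simp [move] <;> ring
  refine Octagon.of_representatives P' S' ?_ ?_ ?_ ?_ link' ?_ ?_ ?_ ?_ ?_ ?_ ?_ ?_ ?_
  · simp [e0, O.ne_nil]
  · simp [e1, O.ne_nil]
  · rw [e0, show (a 6).reverse ++ (a 5).reverse ++ (a 4).reverse ++ (a 3).reverse ++
      (a 2).reverse = (a 2 ++ a 3 ++ a 4 ++ a 5 ++ a 6).reverse by simp]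
    refine InducedPath.translate (InducedPath.reverse hs ?_) _
    have h24 := ((O.path 2).append hs (O.path 3) (O.link 2)).append hs (O.path 4)
      ((O.link 3).append_left (O.apart' (by decide)) (O.ne_nil 3))
    have h25 := h24.append hs (O.path 5) ((O.link 4).append_left
      (apart_append_left.2 ⟨O.apart' (by decide), O.apart' (by decide)⟩) (O.ne_nil 4))
    exact h25.append hs (O.path 6) ((O.link 5).append_left
      (apart_append_left.2 ⟨apart_append_left.2 ⟨O.apart' (by decide), O.apart' (by decide)⟩,
        O.apart' (by decide)⟩) (O.ne_nil 5))
  · rw [e1]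
    exact ((((O.path 0).append hs (O.path 1) (O.link 0)).append hs (O.path 2)
      ((O.link 1).append_left (O.apart' (by decide)) (O.ne_nil 1))).translate _)
  · rw [e0, e2, apart_map_add,
      show (0 + (p + q, 0) - (0, p + q) : ℤ × ℤ) = (p + q, -p - q) by ext <;> simp; ring]
    have v7 : (p + q, -p - q) - move p q 7 = (p, -q) := by ext <;> simp [move]; ring
    have v2 : (p, -q) + move p q 2 = 0 := by ext <;> simp [move]
    have v6 : (p + q, -p - q) - move p q 6 = (q, -p) := by ext <;> simp [move]
    have v3 : (q, -p) + move p q 3 = 0 := by ext <;> simp [move]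
    have k40 : Apart (IsStep r s) (a 4) (a 0) (p + q, -p - q) :=
      O.exchange_left 7 (by decide) v7 (O.apart_move' (k := 6) (by decide))
        (O.apart_move' (k := 6) (by decide))
    have k4 : ∀ j : Fin 8, j = 2 + 4 ∨ j = 2 + 5 →
        Apart (IsStep r s) (a 4) (a j) (p + q, -p - q) := fun j hj =>
      O.exchange_left 7 (by decide) v7
        (O.exchange_right 2 hj v2 (O.apart' (by decide)) (O.apart' (by decide)))
        (O.exchange_right 2 hj v2 (O.apart' (by decide)) (O.apart' (by decide)))
    have k32 : ∀ i j : Fin 8, i = 6 + 4 ∨ i = 6 + 5 → j = 3 + 4 ∨ j = 3 + 5 →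
        Apart (IsStep r s) (a i) (a j) (p + q, -p - q) := fun i j hi hj =>
      O.exchange_left 6 hi v6
        (O.exchange_right 3 hj v3 (O.apart' (by decide)) (O.apart' (by decide)))
        (O.exchange_right 3 hj v3 (O.apart' (by decide)) (O.apart' (by decide)))
    have k326 : ∀ i : Fin 8, i = 6 + 4 ∨ i = 6 + 5 →
        Apart (IsStep r s) (a i) (a 6) (p + q, -p - q) := fun i hi =>
      O.exchange_left 6 hi v6 (O.apart_move' (k := 7) (by decide))
        (O.apart_move' (k := 7) (by decide))
    simp only [apart_append_left, apart_reverse_left]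
    simp only [apart_append_right, apart_reverse_right]
    have ka := fun i hi j hj => H.apart_of_clear (clear_h_02a P i hi j hj)
    have kb := fun i hi j hj => H.apart_of_clear (clear_h_02b P i hi j hj)
    refine ⟨⟨⟨⟨⟨⟨⟨⟨?_, ?_⟩, ?_⟩, ?_⟩, ?_⟩, ⟨⟨⟨⟨?_, ?_⟩, ?_⟩, ?_⟩, ?_⟩⟩,
      ⟨⟨⟨⟨k40, k4 7 (by decide)⟩, k4 6 (by decide)⟩, ?_⟩, ?_⟩⟩,
      ⟨⟨⟨⟨k32 3 0 (by decide) (by decide), k32 3 7 (by decide) (by decide)⟩, k326 3 (by decide)⟩,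
        ?_⟩, ?_⟩⟩,
      ⟨⟨⟨⟨k32 2 0 (by decide) (by decide), k32 2 7 (by decide) (by decide)⟩, k326 2 (by decide)⟩,
        ?_⟩, ?_⟩⟩ <;>
    first
    | exact ka _ (by decide) _ (by decide)
    | exact kb _ (by decide) _ (by decide)
  · rw [e0, e3, apart_map_add,
      show (0 + (p + q, 0) - (-q, q) : ℤ × ℤ) = (p + 2 * q, -q) by ext <;> simp; ring]
    simp only [apart_append_left, apart_reverse_left]
    simp only [apart_append_right]
    refine ⟨⟨⟨⟨⟨⟨?_, ?_⟩, ?_⟩, ⟨⟨?_, ?_⟩, ?_⟩⟩, ⟨⟨?_, ?_⟩, ?_⟩⟩, ⟨⟨?_, ?_⟩, ?_⟩⟩,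
      ⟨⟨?_, ?_⟩, ?_⟩⟩ <;>
    exact H.apart_of_clear (clear_h_03 P _ (by decide) _ (by decide))
  · rw [e0, e4, apart_map_add,
      show (0 + (p + q, 0) - (-p - q, 0) : ℤ × ℤ) = (2 * p + 2 * q, 0) by ext <;> simp; ring]
    simp only [apart_append_left, apart_reverse_left]
    simp only [apart_append_right, apart_reverse_right]
    have k40 := H.apart_west_east fun hc =>
      clear_h_04 P 4 (by decide) 0 (by decide) fun h => hc h.1
    refine ⟨⟨⟨⟨⟨⟨⟨⟨?_, ?_⟩, ?_⟩, ?_⟩, ?_⟩, ⟨⟨⟨⟨?_, ?_⟩, ?_⟩, ?_⟩, ?_⟩⟩,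
      ⟨⟨⟨⟨?_, ?_⟩, k40⟩, ?_⟩, ?_⟩⟩, ⟨⟨⟨⟨?_, ?_⟩, ?_⟩, ?_⟩, ?_⟩⟩,
      ⟨⟨⟨⟨?_, ?_⟩, ?_⟩, ?_⟩, ?_⟩⟩ <;>
    exact H.apart_of_clear (clear_h_04 P _ (by decide) _ (by decide)
      fun h => absurd h.2 (by decide))
  · rw [e1, e3, apart_map_add,
      show (0 + (q, q) - (-q, q) : ℤ × ℤ) = (2 * q, 0) by ext <;> simp; ring]
    simp only [apart_append_left]
    simp only [apart_append_right]
    refine ⟨⟨⟨⟨?_, ?_⟩, ?_⟩, ⟨⟨?_, ?_⟩, ?_⟩⟩, ⟨⟨?_, ?_⟩, ?_⟩⟩ <;>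
    exact H.apart_of_clear (clear_h_13 P _ (by decide) _ (by decide))
  · rw [e1, e5, apart_map_add,
      show (0 + (q, q) - (-q, -q) : ℤ × ℤ) = (2 * q, 2 * q) by ext <;> simp <;> ring]
    simp only [apart_append_left]
    simp only [apart_append_right]
    refine ⟨⟨⟨⟨?_, ?_⟩, ?_⟩, ⟨⟨?_, ?_⟩, ?_⟩⟩, ⟨⟨?_, ?_⟩, ?_⟩⟩ <;>
    exact H.apart_of_clear (clear_h_15 P _ (by decide) _ (by decide))
  · have k5 : (a 6).reverse ++ (a 5).reverse =
        (a 1).map (· + move p q 5) ++ (a 2).map (· + move p q 5) := by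
      rw [← List.reverse_append, ← List.map_append]
      exact (O.exchange 5).symm
    rw [e7, e0, e3, e4, k5]
    simp [Function.comp_def, add_assoc, move]
    ring_nf
    simp only [add_comm]
  · intro _
    rw [e0, apart_map_add, add_sub_cancel_right]
    simp only [apart_append_left, apart_reverse_left]
    simp only [apart_append_right, apart_reverse_right]
    refine ⟨⟨⟨⟨⟨⟨⟨⟨?_, ?_⟩, ?_⟩, ?_⟩, ?_⟩, ⟨⟨⟨⟨?_, ?_⟩, ?_⟩, ?_⟩, ?_⟩⟩,
      ⟨⟨⟨⟨?_, ?_⟩, ?_⟩, ?_⟩, ?_⟩⟩, ⟨⟨⟨⟨?_, ?_⟩, ?_⟩, ?_⟩, ?_⟩⟩,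
      ⟨⟨⟨⟨?_, ?_⟩, ?_⟩, ?_⟩, ?_⟩⟩ <;>
    exact H.apart_of_clear (clear_move_h_00 P _ (by decide) _ (by decide))
  · intro _
    rw [e0, e1, apart_map_add, show move q (p + 2 * q) 2 + (p + q, 0) - (q, q) = (p - q, p + q) by
      ext <;> simp [move]; ring]
    have v1 : (p - q, p + q) - move p q 1 = move p q 3 := by ext <;> simp [move]
    have k1 : ∀ i : Fin 8, i = 1 + 4 ∨ i = 1 + 5 → ∀ j : Fin 8, j ≠ 3 ∧ j ≠ 3 + 1 →
        Apart (IsStep r s) (a i) (a j) (p - q, p + q) := fun i hi j hj =>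
      O.exchange_left 1 hi v1 (O.apart_move' ⟨by decide, by decide, hj⟩)
        (O.apart_move' ⟨by decide, by decide, hj⟩)
    have ka := fun i hi j hj => H.apart_of_clear (clear_move_h_01 P i hi j hj)
    simp only [apart_append_left, apart_reverse_left]
    simp only [apart_append_right]
    refine ⟨⟨⟨⟨⟨⟨?_, ?_⟩, ?_⟩, ⟨⟨?_, ?_⟩, ?_⟩⟩, ⟨⟨?_, ?_⟩, ?_⟩⟩, ⟨⟨?_, ?_⟩, ?_⟩⟩,
      ⟨⟨?_, ?_⟩, ?_⟩⟩ <;>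
    first
    | exact k1 _ (by decide) _ (by decide)
    | exact ka _ (by decide) _ (by decide)
  · intro _
    rw [e1, apart_map_add, add_sub_cancel_right]
    simp only [apart_append_left]
    simp only [apart_append_right]
    refine ⟨⟨⟨⟨?_, ?_⟩, ?_⟩, ⟨⟨?_, ?_⟩, ?_⟩⟩, ⟨⟨?_, ?_⟩, ?_⟩⟩ <;>
    exact H.apart_of_clear (clear_move_h_11 P _ (by decide) _ (by decide))

/-! ### Lifts of all four types -/

/-- The first proportion reached by a lift. -/
def nextP : LiftType → ℤ → ℤ → ℤ
  | .f, p, _ => p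
  | _, _, q => q

/-- The second proportion reached by a lift. -/
def nextQ : LiftType → ℤ → ℤ → ℤ
  | .f, p, q => 2 * p + q
  | .g, p, q => 2 * q - p
  | _, p, q => p + 2 * q

theorem State.lift (t : LiftType) (H : State c J m n r s p q a) :
    ∃ c' J' m' n', State c' J' m' n' r s (nextP t p q) (nextQ t p q) (t.lift p q a) := by
  cases t with
  | f => exact ⟨_, _, _, _, H.f⟩
  | h => exact ⟨_, _, _, _, H.h⟩
  | g =>
    obtain ⟨c', J', m', n', H'⟩ := H.twist
    have := H'.f
    rw [← twist_g] at this
    refine State.of_twist (c := if c' = 2 then 2 else 1) (by split_ifs <;> simp) (J := J' + (r + s))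
      (m := m') (n := n') ?_
    convert this using 1 <;> simp only [nextP, nextQ] <;> ring
  | hbar =>
    obtain ⟨c', J', m', n', H'⟩ := H.twist
    have := H'.h
    rw [← twist_hbar] at this
    refine State.of_twist (c := 1) (by simp) (J := J') (m := m') (n := n') ?_
    convert this using 1 <;> simp only [nextP, nextQ] <;> ring

/-! ### Connectedness under the second leaper -/

/-- The vector `v` is a move of the second leaper of the kind that leads from the `i`-th path to the
`j`-th one. -/
def Leap (p q : ℤ) (i j : Fin 8) (v : ℤ × ℤ) : Prop :=
  ∃ k : Fin 8, (i = k + 4 ∨ i = k + 5) ∧ (j = k ∨ j = k + 1) ∧ v = move p q k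

theorem Leap.symm {i j : Fin 8} {v : ℤ × ℤ} (h : Leap p q i j v) : Leap p q j i (-v) := by
  obtain ⟨k, hi, hj, rfl⟩ := h
  have e : ∀ k : Fin 8, k + 4 + 4 = k ∧ k + 4 + 5 = k + 1 ∧ k + 4 + 1 = k + 5 := by decide
  obtain ⟨e4, e5, e1⟩ := e k
  exact ⟨k + 4, by rwa [e4, e5], by rwa [e1], move_neg p q k⟩

theorem Leap.rot {i j : Fin 8} {v : ℤ × ℤ} (h : Leap p q i j v) :
    Leap p q (i + 2) (j + 2) (rot v) := by
  obtain ⟨k, hi, hj, rfl⟩ := h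
  refine ⟨k + 2, ?_, ?_, (move_add_two p q k).symm⟩
  · rcases hi with rfl | rfl <;> simp [add_right_comm]
  · rcases hj with rfl | rfl <;> simp [add_right_comm]

/-- Two squares, each of them with the number of a path that contains it, are joined by a `Leap`. -/
def Edge (p q : ℤ) (a : OctCycle) (u v : Fin 8 × (ℤ × ℤ)) : Prop :=
  u.2 ∈ a u.1 ∧ v.2 ∈ a v.1 ∧ Leap p q u.1 v.1 (v.2 - u.2)

theorem Edge.symm {u v : Fin 8 × (ℤ × ℤ)} (h : Edge p q a u v) : Edge p q a v u :=
  ⟨h.2.1, h.1, by simpa using h.2.2.symm⟩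

theorem Edge.reflTransGen_symm {u v : Fin 8 × (ℤ × ℤ)}
    (h : Relation.ReflTransGen (Edge p q a) u v) : Relation.ReflTransGen (Edge p q a) v u := by
  induction h with
  | refl => exact .refl
  | tail _ h ih => exact .head h.symm ih

/-- The squares of the cycle are connected by moves of the second leaper. The number of the path is
kept with each square because it tells which copies of the square a lift contains. -/
def LeapConnected (p q : ℤ) (a : OctCycle) : Prop :=
  ∀ u v : Fin 8 × (ℤ × ℤ), u.2 ∈ a u.1 → v.2 ∈ a v.1 → Relation.ReflTransGen (Edge p q a) u v

/-- The numbers, relative to `i`, of the paths that make up the `i`-th path of a lift. -/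
def offsets (t : LiftType) (i : Fin 8) : List (Fin 8) :=
  match t with
  | .f => if (i : ℕ) % 2 = 0 then [5, 4, 3] else [0]
  | .g => if (i : ℕ) % 2 = 0 then [0] else [5, 4, 3]
  | .h => if (i : ℕ) % 2 = 0 then [6, 5, 4, 3, 2] else [7, 0, 1]
  | .hbar => if (i : ℕ) % 2 = 0 then [7, 0, 1] else [6, 5, 4, 3, 2]

/-- The translation applied to the `i`-th path of a lift. -/
def shift (t : LiftType) (p q : ℤ) (i : Fin 8) : ℤ × ℤ :=
  match t with
  | .f => if (i : ℕ) % 2 = 0 then (p + q) • dirVec i else p • dirVec i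
  | .g => if (i : ℕ) % 2 = 0 then (q - p) • dirVec i else q • dirVec i
  | _ => if (i : ℕ) % 2 = 0 then (p + q) • dirVec i else q • dirVec i

theorem mem_lift (t : LiftType) (i : Fin 8) (x : ℤ × ℤ) :
    x ∈ t.lift p q a i ↔ ∃ j, j - i ∈ offsets t i ∧ ∃ y ∈ a j, x = y + shift t p q i := by
  have hj : ∀ {P : Fin 8 → Prop} {l : List (Fin 8)}, (∃ j, j - i ∈ l ∧ P j) ↔ ∃ d ∈ l, P (i + d) :=
    fun {P l} => ⟨fun ⟨j, h, hp⟩ => ⟨_, h, by simpa using hp⟩,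
      fun ⟨d, h, hp⟩ => ⟨i + d, by simpa using h, hp⟩⟩
  have h7 : i - 1 = i + 7 := by
    clear hj
    revert i
    decide
  rw [hj]
  cases t <;> simp only [LiftType.lift, offsets, shift, translatePath] <;> split_ifs <;>
    simp [h7, eq_comm, or_and_right, exists_or, -Prod.exists]

theorem offsets_add_two (t : LiftType) (i : Fin 8) : offsets t (i + 2) = offsets t i := by
  cases t <;> simp only [offsets, fin8_val_add_two]

theorem shift_add_two (t : LiftType) (i : Fin 8) : shift t p q (i + 2) = rot (shift t p q i) := by
  cases t <;> simp only [shift, fin8_val_add_two, dirVec_add_two] <;> split_ifs <;>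
    rw [map_zsmul]

/-- The square `x` of the `j`-th path has a copy in each of the `i`-th and `i'`-th paths of the
lift, and a move joins these. -/
def CopyEdge (t : LiftType) (p q : ℤ) (j i i' : Fin 8) : Prop :=
  j - i ∈ offsets t i ∧ j - i' ∈ offsets t i' ∧
    Leap (nextP t p q) (nextQ t p q) i i' (shift t p q i' - shift t p q i)

theorem CopyEdge.rot {t : LiftType} {j i i' : Fin 8} (h : CopyEdge t p q j i i') :
    CopyEdge t p q (j + 2) (i + 2) (i' + 2) := by
  refine ⟨?_, ?_, ?_⟩
  · rw [offsets_add_two, add_sub_add_right_eq_sub]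
    exact h.1
  · rw [offsets_add_two, add_sub_add_right_eq_sub]
    exact h.2.1
  · rw [shift_add_two, shift_add_two, ← map_sub]
    exact h.2.2.rot

/-- All copies of a square in a lift are connected, each of them to that in the `h`-th path. -/
theorem exists_hub (t : LiftType) (p q : ℤ) (j : Fin 8) :
    ∃ h, ∀ i, j - i ∈ offsets t i → Relation.ReflTransGen (CopyEdge t p q j) i h := by
  revert j
  refine fin8_induction ?_ ?_ ?_
  · cases t with
    | f =>
      refine ⟨4, fun i hi => ?_⟩
      obtain rfl : i = 4 := by
        revert hi
        revert i
        decide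
      exact .refl
    | g =>
      have e30 : CopyEdge .g p q 0 3 0 := ⟨by decide, by decide, 7, by decide, by decide,
        by ext <;> simp [move, shift, nextP, nextQ, dirVec]; ring⟩
      have e50 : CopyEdge .g p q 0 5 0 := ⟨by decide, by decide, 0, by decide, by decide,
        by ext <;> simp [move, shift, nextP, nextQ, dirVec]; ring⟩
      refine ⟨0, fun i hi => ?_⟩
      obtain rfl | rfl | rfl : i = 0 ∨ i = 3 ∨ i = 5 := by
        clear e30 e50
        revert hi
        revert i
        decide
      · exact .refl
      · exact .single e30
      · exact .single e50
    | h =>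
      have e27 : CopyEdge .h p q 0 2 7 := ⟨by decide, by decide, 6, by decide, by decide,
        by ext <;> simp [move, shift, nextP, nextQ, dirVec]; ring⟩
      have e74 : CopyEdge .h p q 0 7 4 := ⟨by decide, by decide, 3, by decide, by decide,
        by ext <;> simp [move, shift, nextP, nextQ, dirVec]; ring⟩
      have e61 : CopyEdge .h p q 0 6 1 := ⟨by decide, by decide, 1, by decide, by decide,
        by ext <;> simp [move, shift, nextP, nextQ, dirVec]; ring⟩
      have e14 : CopyEdge .h p q 0 1 4 := ⟨by decide, by decide, 4, by decide, by decide,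
        by ext <;> simp [move, shift, nextP, nextQ, dirVec]; ring⟩
      refine ⟨4, fun i hi => ?_⟩
      obtain rfl | rfl | rfl | rfl | rfl : i = 2 ∨ i = 7 ∨ i = 4 ∨ i = 1 ∨ i = 6 := by
        clear e27 e74 e61 e14
        revert hi
        revert i
        decide
      · exact .head e27 (.single e74)
      · exact .single e74
      · exact .refl
      · exact .single e14
      · exact .head e61 (.single e14)
    | hbar =>
      have e30 : CopyEdge .hbar p q 0 3 0 := ⟨by decide, by decide, 7, by decide, by decide,
        by ext <;> simp [move, shift, nextP, nextQ, dirVec]; ring⟩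
      have e50 : CopyEdge .hbar p q 0 5 0 := ⟨by decide, by decide, 0, by decide, by decide,
        by ext <;> simp [move, shift, nextP, nextQ, dirVec]; ring⟩
      refine ⟨0, fun i hi => ?_⟩
      obtain rfl | rfl | rfl : i = 3 ∨ i = 0 ∨ i = 5 := by
        clear e30 e50
        revert hi
        revert i
        decide
      · exact .single e30
      · exact .refl
      · exact .single e50
  · cases t with
    | f =>
      have e41 : CopyEdge .f p q 1 4 1 := ⟨by decide, by decide, 0, by decide, by decide,
        by ext <;> simp [move, shift, nextP, nextQ, dirVec]; ring⟩
      have e61 : CopyEdge .f p q 1 6 1 := ⟨by decide, by decide, 1, by decide, by decide,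
        by ext <;> simp [move, shift, nextP, nextQ, dirVec]; ring⟩
      refine ⟨1, fun i hi => ?_⟩
      obtain rfl | rfl | rfl : i = 1 ∨ i = 4 ∨ i = 6 := by
        clear e41 e61
        revert hi
        revert i
        decide
      · exact .refl
      · exact .single e41
      · exact .single e61
    | g =>
      refine ⟨5, fun i hi => ?_⟩
      obtain rfl : i = 5 := by
        revert hi
        revert i
        decide
      exact .refl
    | h =>
      have e61 : CopyEdge .h p q 1 6 1 := ⟨by decide, by decide, 1, by decide, by decide,
        by ext <;> simp [move, shift, nextP, nextQ, dirVec]; ring⟩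
      have e41 : CopyEdge .h p q 1 4 1 := ⟨by decide, by decide, 0, by decide, by decide,
        by ext <;> simp [move, shift, nextP, nextQ, dirVec]; ring⟩
      refine ⟨1, fun i hi => ?_⟩
      obtain rfl | rfl | rfl : i = 6 ∨ i = 1 ∨ i = 4 := by
        clear e61 e41
        revert hi
        revert i
        decide
      · exact .single e61
      · exact .refl
      · exact .single e41
    | hbar =>
      have e30 : CopyEdge .hbar p q 1 3 0 := ⟨by decide, by decide, 7, by decide, by decide,
        by ext <;> simp [move, shift, nextP, nextQ, dirVec]; ring⟩
      have e05 : CopyEdge .hbar p q 1 0 5 := ⟨by decide, by decide, 4, by decide, by decide,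
        by ext <;> simp [move, shift, nextP, nextQ, dirVec]; ring⟩
      have e72 : CopyEdge .hbar p q 1 7 2 := ⟨by decide, by decide, 2, by decide, by decide,
        by ext <;> simp [move, shift, nextP, nextQ, dirVec]; ring⟩
      have e25 : CopyEdge .hbar p q 1 2 5 := ⟨by decide, by decide, 5, by decide, by decide,
        by ext <;> simp [move, shift, nextP, nextQ, dirVec]; ring⟩
      refine ⟨5, fun i hi => ?_⟩
      obtain rfl | rfl | rfl | rfl | rfl : i = 3 ∨ i = 0 ∨ i = 5 ∨ i = 2 ∨ i = 7 := by
        clear e30 e05 e72 e25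
        revert hi
        revert i
        decide
      · exact .head e30 (.single e05)
      · exact .single e05
      · exact .refl
      · exact .single e25
      · exact .head e72 (.single e25)
  · rintro j ⟨h, H⟩
    refine ⟨h + 2, fun i hi => ?_⟩
    have := H (i - 2) (by
      rw [← offsets_add_two, sub_add_cancel]
      rwa [show j - (i - 2) = j + 2 - i by abel])
    have : Relation.ReflTransGen (CopyEdge t p q (j + 2)) (i - 2 + 2) (h + 2) :=
      this.lift (· + 2) fun _ _ => CopyEdge.rot
    rwa [sub_add_cancel] at this

/-- A move that joins squares of the cycle gives a move that joins some copies of these squares. -/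
theorem exists_copies (t : LiftType) (p q : ℤ) (k : Fin 8) :
    ∃ i i', (∀ j, j = k + 4 ∨ j = k + 5 → j - i ∈ offsets t i) ∧
      (∀ j, j = k ∨ j = k + 1 → j - i' ∈ offsets t i') ∧
      Leap (nextP t p q) (nextQ t p q) i i' (move p q k + shift t p q i' - shift t p q i) := by
  revert k
  refine fin8_induction ?_ ?_ ?_
  · cases t with
    | f => exact ⟨0, 4, by decide, by decide, 3, by decide, by decide, by
        ext <;> simp [move, shift, nextP, nextQ, dirVec]; ring⟩
    | g => exact ⟨1, 5, by decide, by decide, 5, by decide, by decide, by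
        ext <;> simp [move, shift, nextP, nextQ, dirVec]; ring⟩
    | h => exact ⟨2, 6, by decide, by decide, 6, by decide, by decide, by
        ext <;> simp [move, shift, nextP, nextQ, dirVec]; ring⟩
    | hbar => exact ⟨7, 3, by decide, by decide, 2, by decide, by decide, by
        ext <;> simp [move, shift, nextP, nextQ, dirVec]; ring⟩
  · cases t with
    | f => exact ⟨2, 6, by decide, by decide, 6, by decide, by decide, by
        ext <;> simp [move, shift, nextP, nextQ, dirVec]; ring⟩
    | g => exact ⟨1, 5, by decide, by decide, 4, by decide, by decide, by
        ext <;> simp [move, shift, nextP, nextQ, dirVec]; ring⟩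
    | h => exact ⟨0, 4, by decide, by decide, 3, by decide, by decide, by
        ext <;> simp [move, shift, nextP, nextQ, dirVec]; ring⟩
    | hbar => exact ⟨3, 7, by decide, by decide, 7, by decide, by decide, by
        ext <;> simp [move, shift, nextP, nextQ, dirVec]; ring⟩
  · rintro k ⟨i, i', h1, h2, h3⟩
    refine ⟨i + 2, i' + 2, fun j hj => ?_, fun j hj => ?_, ?_⟩
    · have := h1 (j - 2) (by rcases hj with rfl | rfl <;> simp [add_sub_right_comm])
      rw [offsets_add_two]
      rwa [show j - (i + 2) = j - 2 - i by abel]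
    · have := h2 (j - 2) (by rcases hj with rfl | rfl <;> simp [add_sub_right_comm])
      rw [offsets_add_two]
      rwa [show j - (i' + 2) = j - 2 - i' by abel]
    · rw [move_add_two, shift_add_two, shift_add_two, ← map_add, ← map_sub]
      exact h3.rot

theorem LeapConnected.lift (H : LeapConnected p q a) (t : LiftType) :
    LeapConnected (nextP t p q) (nextQ t p q) (t.lift p q a) := by
  have copies : ∀ j, ∀ x ∈ a j, ∀ i i', j - i ∈ offsets t i → j - i' ∈ offsets t i' →
      Relation.ReflTransGen (Edge (nextP t p q) (nextQ t p q) (t.lift p q a))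
        (i, x + shift t p q i) (i', x + shift t p q i') := by
    intro j x hx i i' hi hi'
    obtain ⟨h, hh⟩ := exists_hub t p q j
    have key : ∀ i, j - i ∈ offsets t i →
        Relation.ReflTransGen (Edge (nextP t p q) (nextQ t p q) (t.lift p q a))
          (i, x + shift t p q i) (h, x + shift t p q h) := by
      intro i hi
      refine (hh i hi).lift (r := CopyEdge t p q j) (fun i => (i, x + shift t p q i)) ?_
      rintro i i' ⟨h1, h2, h3⟩
      exact ⟨(mem_lift t i _).2 ⟨j, h1, x, hx, rfl⟩, (mem_lift t i' _).2 ⟨j, h2, x, hx, rfl⟩,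
        by simpa using h3⟩
    exact (key i hi).trans (Edge.reflTransGen_symm (key i' hi'))
  rintro ⟨i, _⟩ ⟨i', _⟩ h h'
  obtain ⟨j, hj, x, hx, rfl⟩ := (mem_lift t i _).1 h
  obtain ⟨j', hj', y, hy, rfl⟩ := (mem_lift t i' _).1 h'
  have key : ∀ v, Relation.ReflTransGen (Edge p q a) (j, x) v → ∀ i', v.1 - i' ∈ offsets t i' →
      Relation.ReflTransGen (Edge (nextP t p q) (nextQ t p q) (t.lift p q a))
        (i, x + shift t p q i) (i', v.2 + shift t p q i') := by
    intro v hv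
    induction hv with
    | refl => exact fun i' hi' => copies j x hx i i' hj hi'
    | @tail b c _ hbc ih =>
      intro i' hi'
      obtain ⟨hb, hc, k, h1, h2, h3⟩ := hbc
      obtain ⟨l, l', hl, hl', hleap⟩ := exists_copies t p q k
      refine ((ih l (hl _ h1)).tail ?_).trans (copies c.1 c.2 hc l' i' (hl' _ h2) hi')
      refine ⟨(mem_lift t l _).2 ⟨b.1, hl _ h1, b.2, hb, rfl⟩,
        (mem_lift t l' _).2 ⟨c.1, hl' _ h2, c.2, hc, rfl⟩, ?_⟩
      rw [← h3] at hleap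
      convert hleap using 1
      ext <;> simp <;> ring
  exact key (j', y) (H (j, x) (j', y) hx hy) i' hj'

theorem leapConnected_baseCycle (p q : ℤ) : LeapConnected p q (baseCycle p q) := by
  set b : Fin 8 → Fin 8 × (ℤ × ℤ) := fun i =>
    (i, if (i : ℕ) % 2 = 0 then (q - p) • dirVec i else p • dirVec i) with hb
  have mem : ∀ i x, x ∈ baseCycle p q i → (i, x) = b i := by
    intro i x hx
    simp only [baseCycle] at hx
    simp only [hb]
    split_ifs at hx ⊢ <;> simp_all
  have edge : ∀ k, Edge p q (baseCycle p q) (b (k + 5)) (b k) := by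
    intro k
    refine ⟨?_, ?_, k, Or.inr rfl, Or.inl rfl, ?_⟩
    · simp only [baseCycle, hb]
      split_ifs <;> simp
    · simp only [baseCycle, hb]
      split_ifs <;> simp
    · revert k
      refine forall_fin8 ?_ ?_ ?_ ?_ ?_ ?_ ?_ ?_ <;> ext <;>
        simp [hb, dirVec, move] <;> ring
  have key : ∀ i, Relation.ReflTransGen (Edge p q (baseCycle p q)) (b 0) (b i) := by
    have h3 := Relation.ReflTransGen.single (edge 3)
    have h6 := h3.tail (edge 6)
    have h1 := h6.tail (edge 1)
    have h4 := h1.tail (edge 4)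
    have h7 := h4.tail (edge 7)
    have h2 := h7.tail (edge 2)
    have h5 := h2.tail (edge 5)
    exact forall_fin8 .refl h1 h2 h3 h4 h5 h6 h7
  rintro ⟨i, x⟩ ⟨j, y⟩ hx hy
  rw [mem i x hx, mem j y hy]
  exact (Edge.reflTransGen_symm (key i)).trans (key j)

/-! ### Connected graphs of degree two -/

section Graph

variable {V : Type*} {G H : SimpleGraph V}

/-- A finite connected graph all of whose vertices have degree two is a cycle. -/
theorem exists_cyclic_enumeration [Finite V] (hG : G.Connected)
    (h2 : ∀ v, (G.neighborSet v).ncard = 2) :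
    ∃ (n : ℕ) (e : Fin n ≃ V), ∀ i j : Fin n, G.Adj (e i) (e j) ↔
      ((i : ℕ) + 1) % n = j ∨ ((j : ℕ) + 1) % n = i := by
  obtain ⟨v⟩ := hG.nonempty
  have hcyc : G.IsCycles := fun v _ => h2 v
  have hne : (G.neighborSet v).Nonempty := by
    rw [← Set.ncard_pos (Set.toFinite _), h2]
    norm_num
  obtain ⟨w, hw, hv⟩ := hcyc.exists_cycle_toSubgraph_verts_eq_connectedComponentSupp
    (c := G.connectedComponentMk v) rfl hne
  have : G.LocallyFinite := fun v => Fintype.ofFinite _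
  have h3 := hw.three_le_length
  have mem : ∀ u, u ∈ w.toSubgraph.verts := fun u => by
    rw [hv]
    exact SimpleGraph.ConnectedComponent.sound (hG u v)
  have adj : ∀ x y, G.Adj x y ↔ ∃ i < w.length, (x = w.getVert i ∧ y = w.getVert (i + 1)) ∨
      (x = w.getVert (i + 1) ∧ y = w.getVert i) := fun x y => by
    rw [← hw.adj_toSubgraph_iff_of_isCycles hcyc (mem x), SimpleGraph.Walk.toSubgraph_adj_iff]
    simp only [Sym2.eq_iff]
    grind
  have wrap : ∀ i < w.length, w.getVert (i + 1) = w.getVert ((i + 1) % w.length) := fun i hi => by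
    rcases Nat.lt_or_ge (i + 1) w.length with h | h
    · rw [Nat.mod_eq_of_lt h]
    · rw [show i + 1 = w.length by omega]
      simp
  have inj : ∀ i < w.length, ∀ j < w.length, w.getVert i = w.getVert j → i = j :=
    fun i hi j hj h => hw.getVert_injOn' (Nat.le_sub_one_of_lt hi) (Nat.le_sub_one_of_lt hj) h
  have bij : Function.Bijective (fun i : Fin w.length => w.getVert i) := by
    refine ⟨fun i j h => Fin.ext (inj i i.2 j j.2 h), fun x => ?_⟩
    obtain ⟨i, hi, hle⟩ := SimpleGraph.Walk.mem_support_iff_exists_getVert.1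
      ((SimpleGraph.Walk.mem_verts_toSubgraph w).1 (mem x))
    rcases hle.lt_or_eq with h | h
    · exact ⟨⟨i, h⟩, hi⟩
    · refine ⟨⟨0, by omega⟩, ?_⟩
      show w.getVert 0 = x
      rw [w.getVert_zero, ← hi, h, w.getVert_length]
  refine ⟨w.length, Equiv.ofBijective _ bij, fun i j => ?_⟩
  have hpos : 0 < w.length := by omega
  simp only [Equiv.ofBijective_apply]
  rw [adj]
  constructor
  · rintro ⟨k, hk, ⟨h, h'⟩ | ⟨h, h'⟩⟩
    · rw [wrap k hk] at h'
      rw [inj _ i.2 _ hk h]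
      exact Or.inl (inj _ j.2 _ (Nat.mod_lt _ hpos) h').symm
    · rw [wrap k hk] at h
      rw [inj _ j.2 _ hk h']
      exact Or.inr (inj _ i.2 _ (Nat.mod_lt _ hpos) h).symm
  · rintro (h | h)
    · exact ⟨i, i.2, Or.inl ⟨rfl, by rw [wrap i i.2, h]⟩⟩
    · exact ⟨j, j.2, Or.inr ⟨by rw [wrap j j.2, h], rfl⟩⟩

/-- Both graphs are cycles, and their lengths agree. -/
theorem nonempty_iso_of_ncard_neighborSet [Finite V] (hG : G.Connected) (hH : H.Connected)
    (hG2 : ∀ v, (G.neighborSet v).ncard = 2) (hH2 : ∀ v, (H.neighborSet v).ncard = 2) :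
    Nonempty (G ≃g H) := by
  obtain ⟨n, e, he⟩ := exists_cyclic_enumeration hG hG2
  obtain ⟨n', e', he'⟩ := exists_cyclic_enumeration hH hH2
  obtain rfl : n = n' := Fin.equiv_iff_eq.1 ⟨e.trans e'.symm⟩
  refine ⟨⟨e.symm.trans e', fun {x y} => ?_⟩⟩
  obtain ⟨i, rfl⟩ := e.surjective x
  obtain ⟨j, rfl⟩ := e.surjective y
  simp [he, he']

end Graph

/-! ### The two leaper graphs of an octagon -/

section Octagon

variable {V : Type*} [AddCommGroup V] {St : V → Prop} {ℓ : Fin 8 → V} {a : Fin 8 → List V}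

theorem Octagon.index_unique (O : Octagon St ℓ a) (hs : IsStepSet St) {i j : Fin 8} {x : V}
    (hi : x ∈ a i) (hj : x ∈ a j) : i = j := by
  by_contra hij
  by_cases h1 : j = i + 1
  · subst h1
    exact (O.link i).ne hs hi hj
  by_cases h2 : i = j + 1
  · subst h2
    exact (O.link j).ne hs hj hi
  exact O.apart' ⟨hij, h1, h2⟩ x hi x hj (Or.inl (by simp))

/-- The neighbours of a square under the first leaper are those before and after it on the cycle. -/
theorem Octagon.exists_step_neighbors (O : Octagon St ℓ a) (hs : IsStepSet St) {i : Fin 8} {x : V}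
    (hx : x ∈ a i) : ∃ y z, y ≠ z ∧ (∃ j, y ∈ a j) ∧ (∃ j, z ∈ a j) ∧
      ∀ w, (∃ j, w ∈ a j) → (St (w - x) ↔ w = y ∨ w = z) := by
  have e1 : i - 1 + 1 = i := by simp
  have l1 : Linked St (a (i - 1)) (a i) := by
    have := O.link (i - 1)
    rwa [e1] at this
  have n1 : ∀ i : Fin 8, i - 1 ≠ i + 1 ∧ i + 1 ≠ i - 1 + 1 ∧ i - 1 ≠ i + 1 + 1 := by decide
  have P : InducedPath St (a (i - 1) ++ a i ++ a (i + 1)) :=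
    ((O.path _).append hs (O.path i) l1).append hs (O.path _)
      ((O.link i).append_left (O.apart' (n1 i)) (O.ne_nil i))
  obtain ⟨u, w, huw⟩ := List.append_of_mem hx
  -- the part of the cycle around `x`, cut at `x`
  set U := a (i - 1) ++ u with hU
  set W := w ++ a (i + 1) with hW
  have hl : a (i - 1) ++ a i ++ a (i + 1) = U ++ x :: W := by simp [huw, hU, hW]
  have hUne : U ≠ [] := by simp [hU, O.ne_nil]
  have hWne : W ≠ [] := by simp [hW, O.ne_nil]
  have L1 : Linked St U (x :: W) := P _ _ hl
  have L2 : Linked St (U ++ [x]) W := P _ _ (by rw [hl]; simp)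
  have hmem : ∀ y ∈ a (i - 1) ++ a i ++ a (i + 1), ∃ j, y ∈ a j := by
    intro y hy
    rcases List.mem_append.1 hy with hy | hy
    · rcases List.mem_append.1 hy with hy | hy
      · exact ⟨_, hy⟩
      · exact ⟨_, hy⟩
    · exact ⟨_, hy⟩
  have hy : U.getLast hUne ∈ U := List.getLast_mem _
  have hz : W.head hWne ∈ W := List.head_mem _
  refine ⟨U.getLast hUne, W.head hWne, ?_, hmem _ ?_, hmem _ ?_, ?_⟩
  · intro h
    exact L1.ne hs hy (by rw [h]; exact List.mem_cons_of_mem _ hz)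
  · rw [hl]
    exact List.mem_append_left _ hy
  · rw [hl]
    exact List.mem_append_right _ (List.mem_cons_of_mem _ hz)
  rintro w' ⟨j, hj⟩
  constructor
  · intro hst
    have hw' : w' ∈ U ++ x :: W := by
      rw [← hl]
      by_cases h0 : i = j
      · subst h0
        simp [hj]
      by_cases h1 : j = i + 1
      · subst h1
        simp [hj]
      by_cases h2 : i = j + 1
      · have : j = i - 1 := by rw [h2]; simp
        subst this
        simp [hj]
      exact absurd (Or.inr (by simpa using hst)) (O.apart' ⟨h0, h1, h2⟩ x hx w' hj)
    rcases List.mem_append.1 hw' with h | h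
    · left
      have := (L1.ends w' h x (by simp) (Or.inr (by simpa using hs.neg _ hst))).1
      rw [List.getLast?_eq_getLast_of_ne_nil hUne] at this
      exact (Option.some.inj this).symm
    · rcases List.mem_cons.1 h with rfl | h
      · exact absurd hst (by simpa using hs.zero)
      · right
        have := (L2.ends x (by simp) w' h (Or.inr hst)).2
        rw [List.head?_eq_some_head hWne] at this
        exact (Option.some.inj this).symm
  · rintro (rfl | rfl)
    · have := L1.step _ (by rw [List.getLast?_eq_getLast_of_ne_nil hUne]; rfl) x rfl
      simpa using hs.neg _ this
    · exact L2.step x (by simp) _ (by rw [List.head?_eq_some_head hWne]; rfl)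

/-- A square of the `i`-th path is carried to a square of the cycle by exactly two moves of the
second leaper. -/
theorem Octagon.add_move_mem_iff (O : Octagon St ℓ a) (hs : IsStepSet St)
    (hℓ : ∀ k, -ℓ k = ℓ (k + 4)) {i : Fin 8} {x : V} (hx : x ∈ a i) (k : Fin 8) :
    (∃ j, x + ℓ k ∈ a j) ↔ k = i + 3 ∨ k = i + 4 := by
  have e : ∀ i k : Fin 8, (i = k + 4 ∨ i = k + 5) ↔ (k = i + 3 ∨ k = i + 4) := by decide
  have e4 : ∀ k : Fin 8, k + 4 + 4 = k ∧ k + 4 + 5 = k + 1 ∧ k + 4 + 1 = k + 5 := by decide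
  rw [← e]
  constructor
  · rintro ⟨j, hj⟩
    by_contra hne
    rw [not_or] at hne
    have hjk : j = k ∨ j = k + 1 := by
      by_contra h
      rw [not_or] at h
      exact O.apart_move' ⟨hne.1, hne.2, h.1, h.2⟩ x hx _ hj (Or.inl (by abel))
    -- the opposite move leads back from `x + ℓ k` to `x`
    have hb := O.add_mem (k + 4) (x := x + ℓ k) (by
      rw [(e4 k).1, (e4 k).2.1]
      rcases hjk with rfl | rfl
      · exact Or.inl hj
      · exact Or.inr hj)
    rw [← hℓ, add_neg_cancel_right, (e4 k).2.2] at hb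
    rcases hb with hb | hb
    · exact hne.1 (O.index_unique hs hx hb)
    · exact hne.2 (O.index_unique hs hx hb)
  · intro h
    have : x ∈ a (k + 4) ∨ x ∈ a (k + 5) := by
      rcases h with rfl | rfl
      · exact Or.inl hx
      · exact Or.inr hx
    rcases O.add_mem k this with h | h
    · exact ⟨_, h⟩
    · exact ⟨_, h⟩

end Octagon

/-! ### Leaper graphs -/

section Graph

variable {L : Leaper} {B : Set (ℤ × ℤ)}

theorem ncard_neighborSet_graph {x y z : ℤ × ℤ} (hx : x ∈ B) (hy : y ∈ B) (hz : z ∈ B)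
    (hyz : y ≠ z) (h : ∀ w ∈ B, w - x ∈ L.moves ↔ w = y ∨ w = z) :
    ((L.graph B).neighborSet ⟨x, hx⟩).ncard = 2 := by
  refine Set.ncard_eq_two.2 ⟨⟨y, hy⟩, ⟨z, hz⟩, by simpa using hyz, ?_⟩
  ext ⟨w, hw⟩
  have := h w hw
  simp only [SimpleGraph.mem_neighborSet, Set.mem_insert_iff, Set.mem_singleton_iff,
    Subtype.mk.injEq]
  exact this

theorem connected_graph (hB : B.Nonempty) (h : ∀ x ∈ B, ∀ y ∈ B,
    Relation.ReflTransGen (fun u v => u ∈ B ∧ v ∈ B ∧ v - u ∈ L.moves) x y) :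
    (L.graph B).Connected := by
  have : Nonempty B := hB.to_subtype
  refine ⟨fun x y => ?_⟩
  have key : ∀ y, Relation.ReflTransGen (fun u v => u ∈ B ∧ v ∈ B ∧ v - u ∈ L.moves) x y →
      ∃ hy : y ∈ B, (L.graph B).Reachable x ⟨y, hy⟩ := by
    intro y hy
    induction hy with
    | refl => exact ⟨x.2, .rfl⟩
    | tail _ h ih =>
      obtain ⟨hu, hr⟩ := ih
      refine ⟨h.2.1, hr.trans (SimpleGraph.Adj.reachable ?_)⟩
      exact h.2.2
  exact (key y (h x x.2 y y.2)).2

end Graph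

/-- Consecutive squares of the cycle are joined by moves of the first leaper. -/
theorem Octagon.reflTransGen_step {V : Type*} [AddCommGroup V] {St : V → Prop} {ℓ : Fin 8 → V}
    {a : Fin 8 → List V} (O : Octagon St ℓ a) (hs : IsStepSet St) {i j : Fin 8} {x y : V}
    (hx : x ∈ a i) (hy : y ∈ a j) :
    Relation.ReflTransGen (fun u v => (∃ i, u ∈ a i) ∧ (∃ i, v ∈ a i) ∧ St (v - u)) x y := by
  set R : V → V → Prop := fun u v => (∃ i, u ∈ a i) ∧ (∃ i, v ∈ a i) ∧ St (v - u) with hR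
  have symm : ∀ {u v}, Relation.ReflTransGen R u v → Relation.ReflTransGen R v u := by
    intro u v h
    induction h with
    | refl => exact .refl
    | tail _ h ih => exact .head ⟨h.2.1, h.1, by simpa using hs.neg _ h.2.2⟩ ih
  have chain : ∀ l : List V, l.IsChain (fun u v => St (v - u)) → (∀ u ∈ l, ∃ i, u ∈ a i) →
      ∀ u ∈ l.head?, ∀ v ∈ l, Relation.ReflTransGen R u v := by
    intro l
    induction l with
    | nil => simp
    | cons w l ih =>
      intro hl hm u hu v hv
      obtain rfl : w = u := by simpa using hu
      rcases List.mem_cons.1 hv with rfl | hv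
      · exact .refl
      · rw [List.isChain_cons] at hl
        have hne := List.ne_nil_of_mem hv
        have hh := List.head?_eq_some_head hne
        exact .head ⟨hm _ (by simp), hm _ (by simp), hl.1 _ hh⟩
          (ih hl.2 (fun u hu => hm u (by simp [hu])) _ hh v hv)
  have inside : ∀ i, ∀ u ∈ a i, ∀ v ∈ a i, Relation.ReflTransGen R u v := by
    intro i u hu v hv
    have h := chain (a i) (O.path i).isChain (fun u hu => ⟨i, hu⟩) _
      (List.head?_eq_some_head (O.ne_nil i))
    exact (symm (h u hu)).trans (h v hv)
  have next : ∀ i, ∀ u ∈ a i, ∀ v ∈ a (i + 1), Relation.ReflTransGen R u v := by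
    intro i u hu v hv
    have h1 := List.getLast_mem (O.ne_nil i)
    have h2 := List.head_mem (O.ne_nil (i + 1))
    exact ((inside i u hu _ h1).tail ⟨⟨_, h1⟩, ⟨_, h2⟩, (O.link i).step _
      (List.getLast?_eq_getLast_of_ne_nil _) _ (List.head?_eq_some_head _)⟩).trans
      (inside _ _ h2 v hv)
  have step : ∀ d, (∀ v ∈ a (i + d), Relation.ReflTransGen R x v) →
      ∀ v ∈ a (i + (d + 1)), Relation.ReflTransGen R x v := by
    intro d h v hv
    have h1 := List.head_mem (O.ne_nil (i + d))
    rw [← add_assoc] at hv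
    exact (h _ h1).trans (next _ _ h1 v hv)
  have h0 : ∀ v ∈ a (i + 0), Relation.ReflTransGen R x v :=
    fun v hv => inside i x hx v (by simpa using hv)
  have h2 : ∀ d, (∀ v ∈ a (i + d), Relation.ReflTransGen R x v) →
      ∀ v ∈ a (i + (d + 2)), Relation.ReflTransGen R x v := fun d h => by
    have := step _ (step d h)
    rwa [show d + 1 + 1 = d + 2 by rw [add_assoc]; rfl] at this
  exact fin8_induction (P := fun d => ∀ v ∈ a (i + d), Relation.ReflTransGen R x v) h0
    (by simpa using step 0 h0) h2 (j - i) y (by simpa using hy)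

/-- The cycles built by lifting form dual boards. -/
theorem State.isDualBoard (H : State c J m n r s p q a) (C : LeapConnected p q a) {M L : Leaper}
    (hM : ∀ v, v ∈ M.moves ↔ IsStep r s v) (hp : (L.p : ℤ) = p) (hq : (L.q : ℤ) = q) :
    IsDualBoard {x | ∃ i, x ∈ a i} M L := by
  obtain ⟨P, -, O⟩ := H
  have hs0 : 0 < s := P.1
  have hpq : 0 < p ∧ p < q := ⟨P.2.2.1, P.2.2.2.1⟩
  have hs : IsStepSet (IsStep r s) := isStepSet hs0
  have hL : ∀ v, v ∈ L.moves ↔ ∃ k, v = move p q k := by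
    rintro ⟨x, y⟩
    rw [← not_iff_not, not_exists]
    have e : (∀ k, (x, y) ≠ move p q k) ↔ ¬ ((|x| = p ∧ |y| = q) ∨ (|x| = q ∧ |y| = p)) := by
      simp only [Int.abs_eq_natAbs]
      constructor
      · intro h
        have h0 := h 0
        have h1 := h 1
        have h2 := h 2
        have h3 := h 3
        have h4 := h 4
        have h5 := h 5
        have h6 := h 6
        have h7 := h 7
        simp only [move, ne_eq, Prod.mk.injEq, Matrix.cons_val] at h0 h1 h2 h3 h4 h5 h6 h7
        omega
      · intro h
        refine forall_fin8 ?_ ?_ ?_ ?_ ?_ ?_ ?_ ?_ <;>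
          simp only [move, ne_eq, Prod.mk.injEq, Matrix.cons_val] <;> omega
    rw [e, ← hp, ← hq]
    rfl
  set B : Set (ℤ × ℤ) := {x | ∃ i, x ∈ a i} with hB
  have hfin : Finite B := by
    refine Set.Finite.to_subtype ?_
    have : B = ⋃ i, {x | x ∈ a i} := by ext; simp [hB]
    rw [this]
    exact Set.finite_iUnion fun i => List.finite_toSet _
  obtain ⟨x₀, h₀⟩ := List.exists_mem_of_ne_nil _ (O.ne_nil 0)
  obtain ⟨x₁, h₁⟩ := List.exists_mem_of_ne_nil _ (O.ne_nil 1)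
  have hnt : B.Nontrivial := ⟨x₀, ⟨0, h₀⟩, x₁, ⟨1, h₁⟩, by
    rintro rfl
    exact absurd (O.index_unique hs h₀ h₁) (by decide)⟩
  have hMc : (M.graph B).Connected := connected_graph hnt.nonempty (by
    rintro x ⟨i, hx⟩ y ⟨j, hy⟩
    have := O.reflTransGen_step hs hx hy
    simp only [hM]
    exact this)
  have hLc : (L.graph B).Connected := connected_graph hnt.nonempty (by
    rintro x ⟨i, hx⟩ y ⟨j, hy⟩
    refine (C (i, x) (j, y) hx hy).lift Prod.snd ?_
    rintro u v ⟨hu, hv, k, -, -, h⟩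
    exact ⟨⟨_, hu⟩, ⟨_, hv⟩, (hL _).2 ⟨k, h⟩⟩)
  have hM2 : ∀ v, ((M.graph B).neighborSet v).ncard = 2 := by
    rintro ⟨x, i, hx⟩
    obtain ⟨y, z, hyz, hy, hz, h⟩ := O.exists_step_neighbors hs hx
    exact ncard_neighborSet_graph _ hy hz hyz fun w hw => (hM _).trans (h w hw)
  have hL2 : ∀ v, ((L.graph B).neighborSet v).ncard = 2 := by
    rintro ⟨x, i, hx⟩
    have h := O.add_move_mem_iff hs (move_neg p q) hx
    have hne : ∀ i : Fin 8, move p q (i + 3) ≠ move p q (i + 4) := by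
      refine forall_fin8 ?_ ?_ ?_ ?_ ?_ ?_ ?_ ?_ <;> simp [move] <;> omega
    refine ncard_neighborSet_graph _ ((h _).2 (Or.inl rfl)) ((h _).2 (Or.inr rfl))
      (fun e => hne i (add_left_cancel e)) fun w hw => ?_
    rw [hL]
    constructor
    · rintro ⟨k, hk⟩
      obtain rfl : w = x + move p q k := by rw [← hk]; abel
      rcases (h k).1 hw with rfl | rfl
      · exact Or.inl rfl
      · exact Or.inr rfl
    · rintro (rfl | rfl)
      · exact ⟨_, add_sub_cancel_left _ _⟩
      · exact ⟨_, add_sub_cancel_left _ _⟩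
  refine ⟨fun h => ?_, hnt, hMc, hLc, nonempty_iso_of_ncard_neighborSet hMc hLc hM2 hL2⟩
  -- the sum of the proportions distinguishes the leapers
  have h1 : (p, q) ∈ L.moves := (hL _).2 ⟨1, rfl⟩
  rw [← h, hM] at h1
  simp only [IsStep] at h1
  unfold Params at P
  omega

/-! ### Lifted boards -/

theorem liftedProportions_nil (M : Leaper) (o : LiftType) :
    M.liftedProportions o [] = o.matrix *ᵥ ![(M.p : ℤ), (M.q : ℤ)] := by
  simp [Leaper.liftedProportions, stringMatrix]

theorem liftedProportions_cons (M : Leaper) (o t : LiftType) (e : List LiftType) :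
    M.liftedProportions o (t :: e) = t.matrix *ᵥ M.liftedProportions o e := by
  rw [Leaper.liftedProportions, Leaper.liftedProportions, Matrix.mulVec_mulVec, ← Matrix.mul_assoc]
  simp only [stringMatrix, List.map_cons, List.prod_cons]

theorem matrix_mulVec (t : LiftType) (v : Fin 2 → ℤ) :
    t.matrix *ᵥ v = ![nextP t (v 0) (v 1), nextQ t (v 0) (v 1)] := by
  cases t <;> ext i <;> fin_cases i <;>
    simp [LiftType.matrix, nextP, nextQ, Matrix.mulVec, dotProduct, Fin.sum_univ_two]; ring

/-- The three types of initial cycles of an `(r, s)`-leaper are the initial cycles of type `h` of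
the same leaper with the proportions `(s, r)`, `(-r, s)` and `(r, s)`. -/
theorem exists_proportions (M : Leaper) {o : LiftType} (h : M.p ≤ M.q) (ho : M.HasInitialCycle o) :
    ∃ r s : ℤ, 0 < s ∧ 0 < r + s ∧ (∀ v, v ∈ M.moves ↔ IsStep r s v) ∧
      M.liftedProportions o [] = ![s, r + 2 * s] ∧ M.initialCycle o = baseCycle s (r + 2 * s) := by
  have hpos := M.pos
  have hmoves : ∀ v : ℤ × ℤ, v ∈ M.moves ↔ IsStep M.p M.q v := fun v => by
    simp only [Leaper.moves, IsStep, Set.mem_ofPred_eq, Int.abs_eq_natAbs]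
    omega
  cases o with
  | f =>
    have : M.p ≠ 0 := ho
    refine ⟨M.q, M.p, by omega, by omega, fun v => ?_, ?_, ?_⟩
    · rw [hmoves]
      simp only [IsStep]
      omega
    · rw [liftedProportions_nil, matrix_mulVec]
      simp [nextP, nextQ, add_comm]
    · funext i
      simp only [Leaper.initialCycle, baseCycle]
      rw [show (M.q : ℤ) + 2 * M.p - M.p = M.p + M.q by ring]
  | g =>
    have : M.p ≠ M.q := ho
    refine ⟨-M.p, M.q, by omega, by omega, fun v => ?_, ?_, ?_⟩
    · rw [hmoves]
      simp only [IsStep]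
      omega
    · rw [liftedProportions_nil, matrix_mulVec]
      simp [nextP, nextQ, sub_eq_neg_add]
    · funext i
      simp only [Leaper.initialCycle, baseCycle]
      rw [show -(M.p : ℤ) + 2 * M.q - M.q = M.q - M.p by ring]
  | h =>
    refine ⟨M.p, M.q, by omega, by omega, hmoves, ?_, ?_⟩
    · rw [liftedProportions_nil, matrix_mulVec]
      simp [nextP, nextQ]
    · funext i
      simp only [Leaper.initialCycle, baseCycle]
      rw [show (M.p : ℤ) + 2 * M.q - M.q = M.p + M.q by ring]
  | hbar => exact absurd ho id

theorem exists_isDualBoard_liftedBoard (M : Leaper) (o : LiftType) (e : List LiftType)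
    (h : M.p ≤ M.q) (ho : M.HasInitialCycle o) : ∃ L : Leaper,
      ![(L.p : ℤ), (L.q : ℤ)] = (stringMatrix e * o.matrix) *ᵥ ![(M.p : ℤ), (M.q : ℤ)] ∧
        IsDualBoard (M.liftedBoard o e) M L := by
  obtain ⟨r, s, hs, hrs, hM, hprop, hcyc⟩ := exists_proportions M h ho
  have key : (∃ c J m n, State c J m n r s (M.liftedProportions o e 0) (M.liftedProportions o e 1)
      (M.liftedCycle o e)) ∧
      LeapConnected (M.liftedProportions o e 0) (M.liftedProportions o e 1)
        (M.liftedCycle o e) := by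
    induction e with
    | nil =>
      rw [hprop, show M.liftedCycle o [] = M.initialCycle o from rfl, hcyc]
      exact ⟨State.base hs hrs, leapConnected_baseCycle _ _⟩
    | cons t e ih =>
      obtain ⟨⟨c, J, m, n, H⟩, C⟩ := ih
      rw [liftedProportions_cons, matrix_mulVec]
      exact ⟨H.lift t, C.lift t⟩
  obtain ⟨⟨c, J, m, n, H⟩, C⟩ := key
  have hp := H.params.2.2.1
  have hpq := H.params.2.2.2.1
  have ep : ((M.liftedProportions o e 0).toNat : ℤ) = M.liftedProportions o e 0 :=
    Int.toNat_of_nonneg hp.le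
  have eq : ((M.liftedProportions o e 1).toNat : ℤ) = M.liftedProportions o e 1 :=
    Int.toNat_of_nonneg (hp.trans hpq).le
  refine ⟨⟨(M.liftedProportions o e 0).toNat, (M.liftedProportions o e 1).toNat, by omega⟩, ?_,
    H.isDualBoard C hM ep eq⟩
  rw [ep, eq]
  ext i
  fin_cases i <;> rfl

end LeaperCycle

/-! ### Descents -/

section Descent

open LeaperCycle

theorem IsDualBoard.symm {B : Set (ℤ × ℤ)} {L M : Leaper} (h : IsDualBoard B L M) :
    IsDualBoard B M L :=
  ⟨h.1.symm, h.2.1, h.2.2.2.1, h.2.2.1, h.2.2.2.2.map SimpleGraph.Iso.symm⟩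

theorem Leaper.graph_congr {L L' : Leaper} (h : L.moves = L'.moves) (B : Set (ℤ × ℤ)) :
    L.graph B = L'.graph B := by
  ext x y
  exact Set.ext_iff.1 h _

theorem IsDualBoard.congr {B : Set (ℤ × ℤ)} {L L' M M' : Leaper} (h : IsDualBoard B L M)
    (hL : L.moves = L'.moves) (hM : M.moves = M'.moves) : IsDualBoard B L' M' := by
  unfold IsDualBoard at h ⊢
  rwa [← hL, ← hM, ← Leaper.graph_congr hL, ← Leaper.graph_congr hM]

theorem Leaper.moves_eq_of_min_max {L L' : Leaper} (h1 : min L.p L.q = min L'.p L'.q)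
    (h2 : max L.p L.q = max L'.p L'.q) : L.moves = L'.moves := by
  ext v
  simp only [Leaper.moves, Set.mem_ofPred_eq]
  omega

/-- A frame reached through a string of lifts is obtained by its prefix from the frame reached
through its suffix. -/
theorem FrameLift.exists_append {e d : List LiftType} {p q : ℕ} (H : FrameLift (e ++ d) p q) :
    ∃ m n, FrameLift d m n ∧ ![(p : ℤ), (q : ℤ)] = stringMatrix e *ᵥ ![(m : ℤ), (n : ℤ)] := by
  induction e generalizing p q with
  | nil => exact ⟨p, q, H, by simp [stringMatrix]⟩
  | cons t e ih =>
    have key : ∃ p' q', FrameLift (e ++ d) p' q' ∧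
        ![(p : ℤ), (q : ℤ)] = t.matrix *ᵥ ![(p' : ℤ), (q' : ℤ)] := by
      cases H with
      | f K => exact ⟨_, _, K, by rw [matrix_mulVec]; simp [nextP, nextQ]⟩
      | g K =>
        have := K.lt
        refine ⟨_, _, K, ?_⟩
        rw [matrix_mulVec]
        simp only [nextP, nextQ, Matrix.cons_val]
        rw [Nat.cast_sub (by omega)]
        simp
      | h K => exact ⟨_, _, K, by rw [matrix_mulVec]; simp [nextP, nextQ]⟩
    obtain ⟨p', q', K, h⟩ := key
    obtain ⟨m, n, K', h'⟩ := ih K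
    refine ⟨m, n, K', ?_⟩
    rw [h, h', Matrix.mulVec_mulVec]
    simp [stringMatrix]

theorem FrameLift.eq_of_eq {e : List LiftType} {p q p' q' : ℕ} (H : FrameLift e p q)
    (H' : FrameLift e p' q') : p = p' ∧ q = q' := by
  induction H generalizing p' q' with
  | base =>
    cases H'
    exact ⟨rfl, rfl⟩
  | f _ ih =>
    cases H' with
    | f K =>
      obtain ⟨rfl, rfl⟩ := ih K
      exact ⟨rfl, rfl⟩
  | g _ ih =>
    cases H' with
    | g K =>
      obtain ⟨rfl, rfl⟩ := ih K
      exact ⟨rfl, rfl⟩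
  | h _ ih =>
    cases H' with
    | h K =>
      obtain ⟨rfl, rfl⟩ := ih K
      exact ⟨rfl, rfl⟩

theorem FrameLift.ne_hbar {e d : List LiftType} {p q : ℕ} (H : FrameLift (e ++ .hbar :: d) p q) :
    False := by
  obtain ⟨m, n, K, -⟩ := H.exists_append
  cases K

theorem exists_isDualBoard_of_descent_isSuffix {L M : Leaper} (hLs : L.Skew) (hLb : L.Basic)
    (hMs : M.Skew) (hMb : M.Basic) (hne : L.moves ≠ M.moves)
    (h : M.descent hMs hMb <:+ L.descent hLs hLb) : ∃ B, IsDualBoard B L M := by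
  have HL : FrameLift (L.descent hLs hLb) (min L.p L.q) (max L.p L.q) :=
    (L.existsUnique_descent hLs hLb).choose_spec.1
  have HM : FrameLift (M.descent hMs hMb) (min M.p M.q) (max M.p M.q) :=
    (M.existsUnique_descent hMs hMb).choose_spec.1
  obtain ⟨e, he⟩ := h
  rw [← he] at HL
  obtain ⟨m, n, HM', hmn⟩ := HL.exists_append
  obtain ⟨rfl, rfl⟩ := HM'.eq_of_eq HM
  have hlt := HM.lt
  rcases List.eq_nil_or_concat' e with rfl | ⟨e, t, rfl⟩
  · obtain ⟨h1, h2⟩ := HL.eq_of_eq HM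
    exact absurd (Leaper.moves_eq_of_min_max h1 h2) hne
  have ht : (⟨min M.p M.q, max M.p M.q, Or.inl hlt.1⟩ : Leaper).HasInitialCycle t := by
    cases t with
    | f => exact hlt.1.ne'
    | g => exact hlt.2.ne
    | h => trivial
    | hbar => exact (FrameLift.ne_hbar (by simpa using HL)).elim
  obtain ⟨L', hL', hB⟩ := exists_isDualBoard_liftedBoard _ t e hlt.2.le ht
  have hprod : stringMatrix (e ++ [t]) = stringMatrix e * t.matrix := by simp [stringMatrix]
  rw [← hprod, ← hmn] at hL'
  have h0 : (L'.p : ℤ) = (min L.p L.q : ℕ) := congrFun hL' 0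
  have h1 : (L'.q : ℤ) = (max L.p L.q : ℕ) := congrFun hL' 1
  exact ⟨_, (hB.congr (Leaper.moves_eq_of_min_max (by dsimp only; omega) (by dsimp only; omega))
    (Leaper.moves_eq_of_min_max (by omega) (by omega))).symm⟩

end Descent

theorem mainTheorem9 :
    (∀ (M : Leaper) (o : LiftType) (e : List LiftType),
      M.p ≤ M.q → M.HasInitialCycle o →
        ∃ L : Leaper,
          ![(L.p : ℤ), (L.q : ℤ)] =
            (stringMatrix e * o.matrix) *ᵥ ![(M.p : ℤ), (M.q : ℤ)] ∧
          IsDualBoard (M.liftedBoard o e) M L) ∧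
    (∀ (L M : Leaper) (hLs : L.Skew) (hLb : L.Basic) (hMs : M.Skew) (hMb : M.Basic),
      L.moves ≠ M.moves →
      (L.descent hLs hLb <:+ M.descent hMs hMb ∨ M.descent hMs hMb <:+ L.descent hLs hLb) →
        ∃ B : Set (ℤ × ℤ), IsDualBoard B L M) := by
  refine ⟨LeaperCycle.exists_isDualBoard_liftedBoard, fun L M hLs hLb hMs hMb hne h => ?_⟩
  rcases h with h | h
  · obtain ⟨B, hB⟩ := exists_isDualBoard_of_descent_isSuffix hMs hMb hLs hLb hne.symm h
    exact ⟨B, hB.symm⟩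
  · exact exists_isDualBoard_of_descent_isSuffix hLs hLb hMs hMb hne h
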